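/- Let $d \ge 1$. For a compact set $C \subset \mathbb{R}^d$, the bounded gaps of $C$ are the bounded path-connected components of $\mathbb{R}^d \setminus C$, and $E$ denotes the union of the unbounded path-connected components of $\mathbb{R}^d \setminus C$ (a single component if $d \ge 2$, two intervals if $d = 1$ and $C\neq\emptyset$). If $C$ has bounded gaps, arrange them in a finite or infinite sequence $G_1, G_2, \dots$ of non-increasing diameter and define the thickness of $C$ by $$\tau(C) = \inf_n \frac{\operatorname{dist}\bigl(G_n,\ \bigcup_{1 \le i \le n-1} G_i \cup E\bigr)}{\operatorname{diam}(G_n)};$$ the value does not depend on the choice of the arrangement (if no such arrangement exists, set $\tau(C) = 0$). If $C$ has no bounded gaps, put $\tau(C) = +\infty$ if $C$ has non-empty interior and $\tau(C) = 0$ otherwise. In products, $0 \cdot (+\infty) = 0$. For a finite graph $G$ with adjacency relation $\sim$ and $m$ edges, and a set $B \subset \mathbb{R}^{n}$, the $G$ distance set of $B$ is $$\Delta_G(B) = \bigl\{ (|x^i - x^j|)_{i \sim j} \ :\ x^i \in B \text{ for every vertex } i,\ x^i \ne x^j \text{ for } i \neq j \bigr\} \subset \mathbb{R}^m,$$ where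 $|\cdot|$ is the Euclidean norm and the coordinates are indexed by the edges of $G$. Let $C_1, C_2 \subset \mathbb{R}^d$ be compact sets with $\tau(C_1)\,\tau(C_2) > 1$. Then for every finite tree $T$, the set $\Delta_T(C_1 \times C_2)$, with $C_1 \times C_2 \subset \mathbb{R}^{2d}$, has non-empty interior. -/

import Mathlib

open scoped ENNReal

noncomputable section

/-- The bounded gaps of `C`: the bounded path-connected components of the complement of `C`. -/
def boundedGaps {X : Type*} [MetricSpace X] (C : Set X) : Set (Set X) :=
  {G | ∃ x ∈ Cᶜ, G = pathComponentIn Cᶜ x ∧ Bornology.IsBounded G}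

/-- The unbounded gap `E` of `C`: the union of the unbounded path-connected components of the
complement of `C` (for compact `C` in `ℝ^d` there is one such component if `d ≥ 2`,
and `E` consists of two unbounded intervals if `d = 1` and `C` is non-empty). -/
def unboundedGap {X : Type*} [MetricSpace X] (C : Set X) : Set X :=
  {x | x ∈ Cᶜ ∧ ¬ Bornology.IsBounded (pathComponentIn Cᶜ x)}

/-- The distance `inf {|x - y| : x ∈ A, y ∈ B}` between two sets. -/
def setDist {X : Type*} [MetricSpace X] (A B : Set X) : ℝ≥0∞ :=
  ⨅ x ∈ A, ⨅ y ∈ B, edist x y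

/-- An arrangement of the bounded gaps of `C` in a finite or infinite sequence of non-increasing
diameter; `r G` is the position of the gap `G` in the sequence. -/
def IsGapOrdering {X : Type*} [MetricSpace X] (C : Set X) (r : boundedGaps C → ℕ) : Prop :=
  Function.Injective r ∧
    ∀ G H : boundedGaps C, r G < r H → Metric.ediam (H : Set X) ≤ Metric.ediam (G : Set X)

/-- `inf_n dist (G_n, ⋃_{i < n} G_i ∪ E) / diam G_n`, for the gaps in the order given by `r`. -/
def thicknessAlong {X : Type*} [MetricSpace X] (C : Set X) (r : boundedGaps C → ℕ) : ℝ≥0∞ :=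
  ⨅ G : boundedGaps C,
    setDist (G : Set X)
        ((⋃ H : boundedGaps C, ⋃ _ : r H < r G, (H : Set X)) ∪ unboundedGap C) /
      Metric.ediam (G : Set X)

open Classical in
/-- The thickness `τ(C)`. If `C` has bounded gaps, it is computed along an ordering of the gaps by
non-increasing diameter; by `thickness_eq_thicknessAlong` below, the choice of the ordering is
immaterial, so that the supremum only serves to pick the common value (it is `0` if the gaps of `C`
cannot be so ordered). -/
def thickness {X : Type*} [MetricSpace X] (C : Set X) : ℝ≥0∞ :=
  if (boundedGaps C).Nonempty then
    ⨆ r : {r : boundedGaps C → ℕ // IsGapOrdering C r}, thicknessAlong C r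
  else if (interior C).Nonempty then ∞ else 0

theorem thicknessAlong_le {X : Type*} [NormedAddCommGroup X] [NormedSpace ℝ X] [Nontrivial X]
    {C : Set X} (hC : IsClosed C) {r s : boundedGaps C → ℕ}
    (hr : IsGapOrdering C r) (hs : IsGapOrdering C s) :
    thicknessAlong C r ≤ thicknessAlong C s := by
  have hfin : ∀ G : boundedGaps C, Metric.ediam (G : Set X) ≠ ∞ := by
    rintro ⟨G, x, hx, rfl, hb⟩
    exact hb.ediam_ne_top
  have hpos : ∀ G : boundedGaps C, Metric.ediam (G : Set X) ≠ 0 := by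
    rintro ⟨G, x, hx, rfl, hb⟩ h0
    have hsub : (pathComponentIn Cᶜ x).Subsingleton := Metric.ediam_eq_zero_iff.mp h0
    have hopen : IsOpen (pathComponentIn Cᶜ x) := hC.isOpen_compl.pathComponentIn x
    have hmem : x ∈ pathComponentIn Cᶜ x := mem_pathComponentIn_self hx
    have hsing : pathComponentIn Cᶜ x = {x} := hsub.eq_singleton_of_mem hmem
    have := Module.punctured_nhds_neBot ℝ X x
    exact not_isOpen_singleton x (hsing ▸ hopen)
  have key : ∀ (G : boundedGaps C) (x : X), x ∈ (G : Set X) → ∀ y : X,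
      (y ∈ unboundedGap C ∨ ∃ H : boundedGaps C, r H < r G ∧ y ∈ (H : Set X)) →
      thicknessAlong C r * Metric.ediam (G : Set X) ≤ edist x y := by
    intro G x hx y hy
    have h1 := (ENNReal.le_div_iff_mul_le (Or.inl (hpos G)) (Or.inl (hfin G))).mp
      (iInf_le _ G : thicknessAlong C r ≤ _)
    refine h1.trans ((iInf₂_le x hx).trans (iInf₂_le y ?_))
    rcases hy with hy | ⟨H, hH, hy⟩
    · exact Or.inr hy
    · exact Or.inl (Set.mem_iUnion₂.mpr ⟨H, hH, hy⟩)
  refine le_iInf fun G => ?_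
  rw [ENNReal.le_div_iff_mul_le (Or.inl (hpos G)) (Or.inl (hfin G))]
  refine le_iInf₂ fun x hx => le_iInf₂ fun y hy => ?_
  rcases hy with hy | hy
  · obtain ⟨H, hH, hy⟩ := Set.mem_iUnion₂.mp hy
    have hGH := hs.2 H G hH
    rcases lt_trichotomy (r H) (r G) with h | h | h
    · exact key G x hx y (Or.inr ⟨H, h, hy⟩)
    · exact absurd (hr.1 h ▸ hH) (lt_irrefl _)
    · rw [edist_comm]
      exact (mul_le_mul_right hGH _).trans (key H y hy x (Or.inr ⟨G, h, hx⟩))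
  · exact key G x hx y (Or.inl hy)

/-- The thickness may be computed along any ordering of the gaps by non-increasing diameter. -/
theorem thickness_eq_thicknessAlong {X : Type*} [NormedAddCommGroup X] [NormedSpace ℝ X]
    [Nontrivial X] {C : Set X} (hC : IsClosed C) (hne : (boundedGaps C).Nonempty)
    {r : boundedGaps C → ℕ} (hr : IsGapOrdering C r) :
    thickness C = thicknessAlong C r := by
  rw [thickness, if_pos hne]
  exact le_antisymm (iSup_le fun s => thicknessAlong_le hC s.2 hr)
    (le_iSup (fun s : {r : boundedGaps C → ℕ // IsGapOrdering C r} => thicknessAlong C s) ⟨r, hr⟩)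

/-- `C₁ × C₂` as a subset of `ℝ^d × ℝ^d = ℝ^{2d}` with the Euclidean distance. -/
def euclideanProd {d : ℕ} (C₁ C₂ : Set (EuclideanSpace ℝ (Fin d))) :
    Set (WithLp 2 (EuclideanSpace ℝ (Fin d) × EuclideanSpace ℝ (Fin d))) :=
  {z | z.fst ∈ C₁ ∧ z.snd ∈ C₂}

/-- The `G` distance set of `B`: the vectors of edge lengths `(|x^i - x^j|)_{i ∼ j}`, indexed by
the edges of `G`, for pairwise distinct points `x^i` of `B` indexed by the vertices of `G`. -/
def graphDistanceSet {V X : Type*} [MetricSpace X] (G : SimpleGraph V) (B : Set X) :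
    Set (G.edgeSet → ℝ) :=
  {a | ∃ x : V → X, (∀ i, x i ∈ B) ∧ Function.Injective x ∧
    ∀ (i j : V) (h : G.Adj i j), a ⟨s(i, j), G.mem_edgeSet.mpr h⟩ = dist (x i) (x j)}

end

/-! The tree is built leaf by leaf. Suppose that from every point `x` of the set near a state `s`,
all distances in one short interval are attained at points of the set near a successor state `s'`. A
new leaf can then be attached with its edge length free in an open interval, without disturbing the
other edges. Lengths much smaller than the separation already achieved keep the vertices distinct.
This is `exists_realization_of_isTree`; the rest supplies the states.

For `d ≥ 2` it is enough that both thicknesses are nonzero. `C₁` then contains a nonempty `K` such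
that every small sphere centred in `K` meets `K`: a ball, or part of the frontier of a bounded gap,
where connectedness of spheres is used. One copy `K × {q}` serves as the only state.

For `d = 1` the circle of radius `t` about `(x₁, x₂)` meets `C₁ × C₂` exactly when `(C₁ - x₁)²`
meets `t² - (C₂ - x₂)²`. On short pieces these maps are nearly affine, so thickness drops only by a
factor close to 1 and the product stays above 1. When the left end points of the images nearly
coincide, Newhouse's gap lemma (`IsThickPiece.not_disjoint`) gives a common point, and this is
stable in `x` and `t`. States are pairs of end points of thick pieces, which can be continued
indefinitely because thick pieces can be shortened at either end. -/

open scoped ENNReal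
open Filter Topology

/-! ### Realising trees by attaching leaves -/

/-- A finite tree can be realised with prescribed edge lengths, with uniformly separated vertices,
as soon as every vertex state `s` has a successor state `s'` such that points close to `s` see
points close to `s'` at all distances from a short interval. -/
theorem exists_realization_of_isTree {X S : Type*} [MetricSpace X] [Nonempty S]
    (N : S → Filter X) (hN : ∀ s, (N s).NeBot)
    (H : ∀ s, ∀ δ > (0 : ℝ), ∃ s', ∃ ρ > (0 : ℝ), ∀ A' ∈ N s', ∃ A ∈ N s, ∃ r₁ r₂ : ℝ,
      ρ ≤ r₁ ∧ r₁ < r₂ ∧ r₂ ≤ δ ∧ ∀ x ∈ A, ∀ t ∈ Set.Ioo r₁ r₂, ∃ y ∈ A', dist x y = t)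
    (n : ℕ) : ∀ {V : Type*} [Finite V] (T : SimpleGraph V), T.IsTree → Nat.card V = n →
    ∃ s : V → S, ∃ δ > (0 : ℝ), ∀ A : V → Set X, (∀ i, A i ∈ N (s i)) →
      ∃ t₀ : V → V → ℝ, (∀ i j, t₀ i j = t₀ j i) ∧ ∃ ε > (0 : ℝ),
        ∀ t : V → V → ℝ, (∀ i j, t i j = t j i) → (∀ i j, T.Adj i j → |t i j - t₀ i j| < ε) →
          ∃ x : V → X, (∀ i, x i ∈ A i) ∧ (∀ i j, i ≠ j → δ ≤ dist (x i) (x j)) ∧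
            ∀ i j, T.Adj i j → t i j = dist (x i) (x j) := by
  induction n with
  | zero =>
    intro V _ T hT hV
    have := hT.connected.nonempty
    exact absurd hV Nat.card_pos.ne'
  | succ n ih =>
    intro V _ T hT hV
    classical
    have := Fintype.ofFinite V
    have hne := hT.connected.nonempty
    rcases subsingleton_or_nontrivial V with hs | hs
    · refine ⟨fun _ => Classical.arbitrary S, 1, one_pos, fun A hA => ⟨fun _ _ => 0,
        fun _ _ => rfl, 1, one_pos, fun t _ _ => ?_⟩⟩
      choose x hx using fun i => (hN _).nonempty_of_mem (hA i)
      exact ⟨x, hx, fun i j h => absurd (Subsingleton.elim i j) h,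
        fun i j h => absurd (Subsingleton.elim i j) h.ne⟩
    · obtain ⟨v, hv⟩ := hT.exists_vert_degree_one_of_nontrivial
      have hconn := hT.connected.induce_compl_singleton_of_degree_eq_one hv
      have hT' : (T.induce ({v}ᶜ : Set V)).IsTree :=
        ⟨hconn, hT.isAcyclic.induce _⟩
      obtain ⟨u, hu, huniq⟩ := SimpleGraph.degree_eq_one_iff_existsUnique_adj.mp hv
      have hcard : Nat.card ({v}ᶜ : Set V) = n := by
        have h1 : Nat.card ({v}ᶜ : Set V) = Fintype.card V - 1 := by
          rw [Nat.card_eq_fintype_card, Fintype.card_compl_set]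
          simp
        rw [Nat.card_eq_fintype_card] at hV
        omega
      obtain ⟨s, δ, hδ, hs'⟩ := ih _ hT' hcard
      have huv : u ≠ v := hu.ne'
      let u' : ({v}ᶜ : Set V) := ⟨u, huv⟩
      -- A leaf within `δ / 2` of its neighbour `u` stays `δ / 2` away from the vertices that are
      -- `δ`-separated from `u`; `ρ` separates it from `u` itself.
      obtain ⟨sv, ρ, hρ, hsv⟩ := H (s u') (δ / 2) (by positivity)
      refine ⟨fun i => if h : i = v then sv else s ⟨i, h⟩, min ρ (δ / 2), by positivity, ?_⟩
      intro A hA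
      have hAv : A v ∈ N sv := by simpa using hA v
      obtain ⟨A₁, hA₁, r₁, r₂, hr₁, hr, hr₂, hpin⟩ := hsv _ hAv
      -- The neighbour of the leaf is confined to `A₁`, where all lengths in `(r₁, r₂)` are
      -- available.
      obtain ⟨t₀, ht₀, ε, hε, hreal⟩ := hs' (fun i => if i = u' then A i ∩ A₁ else A i) (by
        rintro ⟨i, hi⟩
        have hi' : i ≠ v := hi
        have := hA i
        simp only [hi', dite_false] at this
        split_ifs with h
        · refine inter_mem this ?_
          rw [h]; exact hA₁
        · exact this)
      refine ⟨fun i j => if h : i ≠ v ∧ j ≠ v then t₀ ⟨i, h.1⟩ ⟨j, h.2⟩ else (r₁ + r₂) / 2, ?_,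
        min ε ((r₂ - r₁) / 2), lt_min hε (by linarith), ?_⟩
      · intro i j
        by_cases hi : i = v <;> by_cases hj : j = v <;> simp [hi, hj]
        exact ht₀ _ _
      intro t ht hclose
      obtain ⟨x, hxA, hxδ, hxt⟩ := hreal (fun i j => t i j) (fun i j => ht _ _) (by
        rintro ⟨i, hi⟩ ⟨j, hj⟩ hij
        have hi' : i ≠ v := hi
        have hj' : j ≠ v := hj
        have h := hclose i j hij
        simp only [hi', hj', ne_eq, not_false_eq_true, and_self, dite_true] at h
        exact h.trans_le (min_le_left _ _))
      have hxu : x u' ∈ A₁ := by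
        have := hxA u'
        simp only [if_true] at this
        exact this.2
      have htu := hclose v u hu
      simp only [ne_eq, not_true_eq_false, false_and, dite_false] at htu
      have htu' := abs_lt.mp (htu.trans_le (min_le_right _ _))
      obtain ⟨y, hy, hxy⟩ := hpin _ hxu (t v u) ⟨by linarith, by linarith⟩
      have hsep : ∀ i : ({v}ᶜ : Set V), min ρ (δ / 2) ≤ dist (x i) y := by
        intro i
        by_cases h : i = u'
        · rw [h, hxy]
          exact (min_le_left _ _).trans (by linarith)
        · have h1 := hxδ i u' h
          have h2 := dist_triangle_right (x i) (x u') y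
          exact (min_le_right _ _).trans (by linarith)
      refine ⟨fun i => if h : i = v then y else x ⟨i, h⟩, ?_, ?_, ?_⟩
      · intro i
        by_cases h : i = v
        · subst h; simpa using hy
        · have := hxA ⟨i, h⟩
          simp only [h, dite_false]
          split_ifs at this
          · exact this.1
          · exact this
      · intro i j hij
        by_cases hi : i = v <;> by_cases hj : j = v
        · exact absurd (hi.trans hj.symm) hij
        · simp only [hi, hj, dite_true, dite_false]
          rw [dist_comm]; exact hsep _
        · simp only [hi, hj, dite_true, dite_false]
          exact hsep _
        · simp only [hi, hj, dite_false]
          exact (min_le_right _ _).trans (by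
            have := hxδ ⟨i, hi⟩ ⟨j, hj⟩ fun h => hij (congrArg Subtype.val h)
            linarith)
      · intro i j hij
        by_cases hi : i = v <;> by_cases hj : j = v
        · exact absurd (hi.trans hj.symm) hij.ne
        · subst hi
          obtain rfl := huniq j hij
          simp only [hj, dite_true, dite_false]
          rw [dist_comm, hxy]
        · subst hj
          obtain rfl := huniq i hij.symm
          simp only [hi, dite_true, dite_false]
          rw [hxy, ht]
        · simp only [hi, hj, dite_false]
          exact hxt ⟨i, hi⟩ ⟨j, hj⟩ hij

/-- The realisation with all vertex sets equal to `B` prescribes the edge lengths independently,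
which yields a sup-norm ball; the separation of the vertices gives injectivity. -/
theorem interior_graphDistanceSet_nonempty {X S : Type*} [MetricSpace X] [Nonempty S] {B : Set X}
    (N : S → Filter X) (hN : ∀ s, (N s).NeBot) (hB : ∀ s, B ∈ N s)
    (H : ∀ s, ∀ δ > (0 : ℝ), ∃ s', ∃ ρ > (0 : ℝ), ∀ A' ∈ N s', ∃ A ∈ N s, ∃ r₁ r₂ : ℝ,
      ρ ≤ r₁ ∧ r₁ < r₂ ∧ r₂ ≤ δ ∧ ∀ x ∈ A, ∀ t ∈ Set.Ioo r₁ r₂, ∃ y ∈ A', dist x y = t)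
    {V : Type*} [Finite V] {T : SimpleGraph V} (hT : T.IsTree) :
    (interior (graphDistanceSet T B)).Nonempty := by
  obtain ⟨s, δ, hδ, h⟩ := exists_realization_of_isTree N hN H _ T hT rfl
  obtain ⟨t₀, ht₀, ε, hε, h⟩ := h (fun _ => B) (fun i => hB _)
  have := Fintype.ofFinite T.edgeSet
  let a₀ : T.edgeSet → ℝ := fun e => Sym2.lift ⟨t₀, ht₀⟩ e
  refine ⟨a₀, mem_interior.mpr ⟨Metric.ball a₀ ε, ?_, Metric.isOpen_ball,
    Metric.mem_ball_self hε⟩⟩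
  intro a ha
  classical
  let t : V → V → ℝ := fun i j => if hij : T.Adj i j then a ⟨s(i, j), hij⟩ else 0
  have htij : ∀ i j (hij : T.Adj i j), t i j = a ⟨s(i, j), hij⟩ := fun i j hij => dif_pos hij
  obtain ⟨x, hxB, hxδ, hxt⟩ := h t (by
    intro i j
    by_cases hij : T.Adj i j
    · rw [htij i j hij, htij j i hij.symm]
      congr 2
      exact Sym2.eq_swap
    · have hji : ¬ T.Adj j i := fun h => hij h.symm
      simp [t, hij, hji]) (by
    intro i j hij
    rw [htij i j hij]
    have h1 : dist (a ⟨s(i, j), hij⟩) (a₀ ⟨s(i, j), hij⟩) < ε :=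
      (dist_le_pi_dist a a₀ _).trans_lt ha
    exact h1)
  refine ⟨x, hxB, fun i j hij => ?_, fun i j hij => ?_⟩
  · by_contra hne
    have := hxδ i j hne
    rw [hij, dist_self] at this
    linarith
  · rw [← hxt i j hij, htij i j hij]

/-! ### Thick pieces on the line -/

/-- `C ∩ [a, b]` has extreme points `a` and `b`, and its gaps satisfy the thickness condition with
constant `τ`. -/
structure IsThickPiece (C : Set ℝ) (τ a b : ℝ) : Prop where
  lt : a < b
  left_mem : a ∈ C
  right_mem : b ∈ C
  left_le : ∀ u ∈ C, ∀ v ∈ C, a ≤ u → u < v → v ≤ b → Disjoint (Set.Ioo u v) C →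
    τ * (v - u) ≤ u - a
  right_le : ∀ u ∈ C, ∀ v ∈ C, a ≤ u → u < v → v ≤ b → Disjoint (Set.Ioo u v) C →
    τ * (v - u) ≤ b - v
  gap_le : ∀ u ∈ C, ∀ v ∈ C, ∀ s ∈ C, ∀ t ∈ C, a ≤ u → u < v → v ≤ s → s < t → t ≤ b →
    Disjoint (Set.Ioo u v) C → Disjoint (Set.Ioo s t) C →
    τ * min (v - u) (t - s) ≤ s - v

theorem disjoint_Ioo_neg {C : Set ℝ} {u v : ℝ} (h : Disjoint (Set.Ioo u v) {x | -x ∈ C}) :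
    Disjoint (Set.Ioo (-v) (-u)) C := by
  rw [Set.disjoint_left] at h ⊢
  intro x hx hxC
  exact h (a := -x) ⟨by linarith [hx.2], by linarith [hx.1]⟩ (by simpa using hxC)

theorem IsThickPiece.neg {C : Set ℝ} {τ a b : ℝ} (h : IsThickPiece C τ a b) :
    IsThickPiece {x | -x ∈ C} τ (-b) (-a) where
  lt := neg_lt_neg h.lt
  left_mem := by simpa using h.right_mem
  right_mem := by simpa using h.left_mem
  left_le u hu v hv hau huv hvb hd := by
    have := h.right_le (-v) hv (-u) hu (by linarith) (by linarith) (by linarith)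
      (disjoint_Ioo_neg hd)
    rw [show -u - -v = v - u by ring] at this
    linarith
  right_le u hu v hv hau huv hvb hd := by
    have := h.left_le (-v) hv (-u) hu (by linarith) (by linarith) (by linarith)
      (disjoint_Ioo_neg hd)
    rw [show -u - -v = v - u by ring] at this
    linarith
  gap_le u hu v hv s hs t ht hau huv hvs hst htb hd hd' := by
    have := h.gap_le (-t) ht (-s) hs (-v) hv (-u) hu (by linarith) (by linarith) (by linarith)
      (by linarith) (by linarith) (disjoint_Ioo_neg hd') (disjoint_Ioo_neg hd)
    rw [show -u - -v = v - u by ring, show -s - -t = t - s by ring, min_comm] at this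
    linarith

/-- A point of `[a, b]` outside `C` lies in a gap of `C`. -/
theorem exists_gap {C : Set ℝ} (hC : IsClosed C) {a b w : ℝ} (ha : a ∈ C) (hb : b ∈ C)
    (haw : a ≤ w) (hwb : w ≤ b) (hw : w ∉ C) :
    ∃ u ∈ C, ∃ v ∈ C, a ≤ u ∧ u < w ∧ w < v ∧ v ≤ b ∧ Disjoint (Set.Ioo u v) C := by
  have h1 : IsCompact (C ∩ Set.Icc a w) := isCompact_Icc.inter_left hC
  have h2 : IsCompact (C ∩ Set.Icc w b) := isCompact_Icc.inter_left hC
  obtain ⟨u, ⟨huC, hu⟩, humax⟩ := h1.exists_isGreatest ⟨a, ha, le_rfl, haw⟩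
  obtain ⟨v, ⟨hvC, hv⟩, hvmin⟩ := h2.exists_isLeast ⟨b, hb, hwb, le_rfl⟩
  refine ⟨u, huC, v, hvC, hu.1, lt_of_le_of_ne hu.2 fun h => hw (h ▸ huC),
    lt_of_le_of_ne hv.1 fun h => hw (h ▸ hvC), hv.2, Set.disjoint_left.mpr ?_⟩
  rintro x ⟨hux, hxv⟩ hx
  rcases le_total x w with h | h
  · exact absurd (humax ⟨hx, hu.1.trans hux.le, h⟩) (not_le.mpr hux)
  · exact absurd (hvmin ⟨hx, h, hxv.le.trans hv.2⟩) (not_le.mpr hxv)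

/-- With degenerate gaps allowed, being a gap is a closed condition; longest gaps and shortest
linked pairs then exist by compactness. -/
theorem isClosed_setOf_disjoint_Ioo (C : Set ℝ) :
    IsClosed {p : ℝ × ℝ | Disjoint (Set.Ioo p.1 p.2) C} := by
  have : {p : ℝ × ℝ | Disjoint (Set.Ioo p.1 p.2) C} =
      ⋂ x ∈ C, {p : ℝ × ℝ | x ≤ p.1 ∨ p.2 ≤ x} := by
    ext p
    simp only [Set.mem_ofPred_eq, Set.mem_iInter, Set.disjoint_left, Set.mem_Ioo]
    constructor
    · intro h x hx
      by_contra! hcon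
      exact h hcon hx
    · intro h x hx hxC
      rcases h x hxC with h | h
      · exact absurd hx.1 (not_lt.mpr h)
      · exact absurd hx.2 (not_lt.mpr h)
  rw [this]
  exact isClosed_biInter fun x _ => (isClosed_le continuous_const continuous_fst).union
    (isClosed_le continuous_snd continuous_const)

/-- Thick pieces can be shortened, keeping their left end point. -/
theorem IsThickPiece.exists_short_left {C : Set ℝ} (hC : IsClosed C) {τ a b : ℝ} (hτ : 0 < τ)
    (h : IsThickPiece C τ a b) {η : ℝ} (hη : 0 < η) :
    ∃ b', b' ≤ b ∧ b' < a + η ∧ IsThickPiece C τ a b' := by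
  obtain ⟨c, hcC, hac, hcη, hcb⟩ : ∃ c ∈ C, a < c ∧ c < a + η ∧ c ≤ b := by
    let w := min (a + η / 2) b
    have haw : a < w := lt_min (by linarith) h.lt
    have hwη : w < a + η := (min_le_left _ _).trans_lt (by linarith)
    by_cases hw : w ∈ C
    · exact ⟨w, hw, haw, hwη, min_le_right _ _⟩
    · obtain ⟨u, hu, v, hv, hau, huw, hwv, hvb, hd⟩ :=
        exists_gap hC h.left_mem h.right_mem haw.le (min_le_right _ _) hw
      have h1 := h.left_le u hu v hv hau (huw.trans hwv) hvb hd
      have h2 : 0 < τ * (v - u) := mul_pos hτ (by linarith)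
      exact ⟨u, hu, by linarith, huw.trans hwη, by linarith⟩
  -- The piece is cut at the left end `u₀` of a longest gap of `[a, c]`: every gap before it is no
  -- longer, so `gap_le` against `(u₀, v₀)` becomes `right_le` for the new end point.
  let K : Set (ℝ × ℝ) := ((C ∩ Set.Icc a c) ×ˢ (C ∩ Set.Icc a c)) ∩
    {p | Disjoint (Set.Ioo p.1 p.2) C}
  have hK : IsCompact K :=
    ((isCompact_Icc.inter_left hC).prod (isCompact_Icc.inter_left hC)).inter_right
      (isClosed_setOf_disjoint_Ioo C)
  obtain ⟨⟨u₀, v₀⟩, ⟨⟨⟨hu₀C, hu₀⟩, ⟨hv₀C, hv₀⟩⟩, hd₀⟩, hmax⟩ :=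
    hK.exists_isMaxOn ⟨(a, a), ⟨⟨h.left_mem, le_rfl, hac.le⟩, ⟨h.left_mem, le_rfl, hac.le⟩⟩,
      by simp⟩ (f := fun p => p.2 - p.1) (by fun_prop)
  have hmax' : ∀ u ∈ C, ∀ v ∈ C, a ≤ u → u < v → v ≤ c → Disjoint (Set.Ioo u v) C →
      v - u ≤ v₀ - u₀ := fun u hu v hv hau huv hvc hd =>
    hmax (show (u, v) ∈ K from ⟨⟨⟨hu, hau, by linarith⟩, ⟨hv, by linarith, hvc⟩⟩, hd⟩)
  simp only [Set.mem_Icc] at hu₀ hv₀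
  rcases le_or_gt v₀ u₀ with hle | hlt
  · have hno : ∀ u ∈ C, ∀ v ∈ C, a ≤ u → u < v → v ≤ c → Disjoint (Set.Ioo u v) C → False :=
      fun u hu v hv hau huv hvc hd => by linarith [hmax' u hu v hv hau huv hvc hd]
    exact ⟨c, hcb, hcη, hac, h.left_mem, hcC,
      fun u hu v hv hau huv hvc hd => (hno u hu v hv hau huv hvc hd).elim,
      fun u hu v hv hau huv hvc hd => (hno u hu v hv hau huv hvc hd).elim,
      fun u hu v hv s _ t _ hau huv hvs hst htc hd _ =>
        (hno u hu v hv hau huv (by linarith) hd).elim⟩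
  · have h1 := h.left_le u₀ hu₀C v₀ hv₀C hu₀.1 hlt (hv₀.2.trans hcb) hd₀
    have h2 : 0 < τ * (v₀ - u₀) := mul_pos hτ (by linarith)
    refine ⟨u₀, by linarith, by linarith, by linarith, h.left_mem, hu₀C, ?_, ?_, ?_⟩
    · intro u hu v hv hau huv hvu hd
      exact h.left_le u hu v hv hau huv (by linarith) hd
    · intro u hu v hv hau huv hvu hd
      have h3 := h.gap_le u hu v hv u₀ hu₀C v₀ hv₀C hau huv hvu hlt (by linarith) hd hd₀
      rwa [min_eq_left (hmax' u hu v hv hau huv (by linarith) hd)] at h3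
    · intro u hu v hv s hs t ht hau huv hvs hst htu hd hd'
      exact h.gap_le u hu v hv s hs t ht hau huv hvs hst (by linarith) hd hd'

/-- Thick pieces can be shortened, keeping their right end point. -/
theorem IsThickPiece.exists_short_right {C : Set ℝ} (hC : IsClosed C) {τ a b : ℝ} (hτ : 0 < τ)
    (h : IsThickPiece C τ a b) {η : ℝ} (hη : 0 < η) :
    ∃ a', a ≤ a' ∧ b - η < a' ∧ IsThickPiece C τ a' b := by
  obtain ⟨c, hc, hcη, h'⟩ := h.neg.exists_short_left (hC.preimage continuous_neg) hτ hη
  refine ⟨-c, by linarith, by linarith, ?_⟩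
  simpa using h'.neg

/-- The image of a thick piece under a nearly affine increasing map. -/
theorem IsThickPiece.image {C : Set ℝ} {τ a b : ℝ} (hτ : 0 < τ) (h : IsThickPiece C τ a b)
    {φ : ℝ → ℝ} {m M l : ℝ} (hm : 0 < m) (hl : 0 < l) (hlM : l * M ≤ m)
    (hφm : ∀ x ∈ Set.Icc a b, ∀ y ∈ Set.Icc a b, x ≤ y → m * (y - x) ≤ φ y - φ x)
    (hφM : ∀ x ∈ Set.Icc a b, ∀ y ∈ Set.Icc a b, x ≤ y → φ y - φ x ≤ M * (y - x)) :
    IsThickPiece (φ '' (C ∩ Set.Icc a b)) (l * τ) (φ a) (φ b) := by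
  have hmono : StrictMonoOn φ (Set.Icc a b) := fun x hx y hy hxy => by
    have h1 := hφm x hx y hy hxy.le
    have h2 : 0 < m * (y - x) := mul_pos hm (by linarith)
    linarith
  have ha : a ∈ Set.Icc a b := ⟨le_rfl, h.lt.le⟩
  have hb : b ∈ Set.Icc a b := ⟨h.lt.le, le_rfl⟩
  have hgap : ∀ u ∈ Set.Icc a b, ∀ v ∈ Set.Icc a b,
      Disjoint (Set.Ioo (φ u) (φ v)) (φ '' (C ∩ Set.Icc a b)) → Disjoint (Set.Ioo u v) C := by
    intro u hu v hv hd
    rw [Set.disjoint_left] at hd ⊢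
    intro x hx hxC
    have hx' : x ∈ Set.Icc a b := ⟨hu.1.trans hx.1.le, hx.2.le.trans hv.2⟩
    exact hd ⟨hmono hu hx' hx.1, hmono hx' hv hx.2⟩ ⟨x, ⟨hxC, hx'⟩, rfl⟩
  have key : ∀ x g y z : ℝ, τ * x ≤ y → g ≤ M * x → m * y ≤ z → 0 ≤ x →
      l * τ * g ≤ z := by
    intro x g y z h1 h2 h3 h4
    calc l * τ * g ≤ l * τ * (M * x) := by gcongr
      _ = (l * M) * (τ * x) := by ring
      _ ≤ m * (τ * x) := by gcongr
      _ ≤ m * y := by gcongr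
      _ ≤ z := h3
  refine ⟨hmono ha hb h.lt, ⟨a, ⟨h.left_mem, ha⟩, rfl⟩, ⟨b, ⟨h.right_mem, hb⟩, rfl⟩, ?_, ?_, ?_⟩
  · rintro _ ⟨u, ⟨huC, hu⟩, rfl⟩ _ ⟨v, ⟨hvC, hv⟩, rfl⟩ - huv - hd
    have huv' := (hmono.lt_iff_lt hu hv).mp huv
    exact key _ _ _ _ (h.left_le u huC v hvC hu.1 huv' hv.2 (hgap u hu v hv hd))
      (hφM u hu v hv huv'.le) (hφm a ha u hu hu.1) (by linarith)
  · rintro _ ⟨u, ⟨huC, hu⟩, rfl⟩ _ ⟨v, ⟨hvC, hv⟩, rfl⟩ - huv - hd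
    have huv' := (hmono.lt_iff_lt hu hv).mp huv
    exact key _ _ _ _ (h.right_le u huC v hvC hu.1 huv' hv.2 (hgap u hu v hv hd))
      (hφM u hu v hv huv'.le) (hφm v hv b hb hv.2) (by linarith)
  · rintro _ ⟨u, ⟨huC, hu⟩, rfl⟩ _ ⟨v, ⟨hvC, hv⟩, rfl⟩ _ ⟨s, ⟨hsC, hs⟩, rfl⟩
      _ ⟨t, ⟨htC, ht⟩, rfl⟩ - huv hvs hst - hd hd'
    have huv' := (hmono.lt_iff_lt hu hv).mp huv
    have hst' := (hmono.lt_iff_lt hs ht).mp hst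
    have hvs' := (hmono.le_iff_le hv hs).mp hvs
    have hM : 0 < M := by
      have h1 := hφM u hu v hv huv'.le
      by_contra! hM
      have : M * (v - u) ≤ 0 := mul_nonpos_of_nonpos_of_nonneg hM (by linarith)
      linarith
    refine key _ _ _ _ (h.gap_le u huC v hvC s hsC t htC hu.1 huv' hvs' hst' ht.2
      (hgap u hu v hv hd) (hgap s hs t ht hd')) ?_ (hφm v hv s hs hvs')
      (le_min (by linarith) (by linarith))
    rw [mul_min_of_nonneg _ _ hM.le]
    exact min_le_min (hφM u hu v hv huv'.le) (hφM s hs t ht hst'.le)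

/-! ### The gap lemma -/

/-- `(u, v)` is a gap of `A ∩ [a, a']`, `(s, t)` is a gap of `B ∩ [b, b']`, and `s ≤ v`, `u ≤ s`,
`v ≤ t`. -/
structure IsLinkedGapPair (A B : Set ℝ) (a a' b b' u v s t : ℝ) : Prop where
  u_mem : u ∈ A
  v_mem : v ∈ A
  s_mem : s ∈ B
  t_mem : t ∈ B
  a_le : a ≤ u
  le_a' : v ≤ a'
  b_le : b ≤ s
  le_b' : t ≤ b'
  u_le_s : u ≤ s
  s_le_v : s ≤ v
  v_le_t : v ≤ t
  disj_A : Disjoint (Set.Ioo u v) A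
  disj_B : Disjoint (Set.Ioo s t) B

/-- Since `τ₁ * τ₂ > 1`, either `t - s < τ₁ * (v - u)` or `v - u < τ₂ * (t - s)`. In the first case
`t` lies in a gap of `A` too close to `(u, v)` to be as long as it; in the second, the same holds
for `u` and `B`. -/
theorem IsLinkedGapPair.exists_smaller {A B : Set ℝ} (hA : IsClosed A) (hB : IsClosed B)
    {τ₁ τ₂ a a' b b' u v s t : ℝ} (hτ₁ : 0 < τ₁) (hτ : 1 < τ₁ * τ₂)
    (hpA : IsThickPiece A τ₁ a a') (hpB : IsThickPiece B τ₂ b b')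
    (hd : Disjoint A B) (h : IsLinkedGapPair A B a a' b b' u v s t) :
    (∃ u' v', IsLinkedGapPair B A b b' a a' s t u' v' ∧ v' - u' < v - u) ∨
      ∃ s' t', IsLinkedGapPair B A b b' a a' s' t' u v ∧ t' - s' < t - s := by
  obtain ⟨hu, hv, hs, ht, hau, hva, hbs, htb, hus, hsv, hvt, hdA, hdB⟩ := h
  have hne : ∀ x ∈ A, ∀ y ∈ B, x ≠ y := fun x hx y hy h => Set.disjoint_left.mp hd hx (h ▸ hy)
  have hus' := lt_of_le_of_ne hus (hne u hu s hs)
  have hsv' := lt_of_le_of_ne hsv (hne v hv s hs).symm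
  have hvt' := lt_of_le_of_ne hvt (hne v hv t ht)
  have hr := hpA.right_le u hu v hv hau (by linarith) hva hdA
  have hl := hpB.left_le s hs t ht hbs (by linarith) htb hdB
  rcases lt_or_ge (t - s) (τ₁ * (v - u)) with hcase | hcase
  · left
    obtain ⟨u', hu', v', hv', hvu', hut, htv, hva', hd'⟩ := exists_gap hA hv hpA.right_mem
      hvt (by linarith) fun htA => hne t htA t ht rfl
    refine ⟨u', v', ⟨hs, ht, hu', hv', hbs, htb, hau.trans (by linarith), hva', by linarith,
      hut.le, htv.le, hdB, hd'⟩, ?_⟩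
    have hg := hpA.gap_le u hu v hv u' hu' v' hv' hau (by linarith) hvu' (by linarith) hva' hdA hd'
    by_contra! hcon
    rw [min_eq_left hcon] at hg
    linarith
  · right
    have hcase' : v - u < τ₂ * (t - s) := by
      have hτ₂ : 0 < τ₂ := pos_of_mul_pos_right (one_pos.trans hτ) hτ₁.le
      calc v - u < τ₁ * τ₂ * (v - u) := lt_mul_of_one_lt_left (by linarith) hτ
        _ = τ₂ * (τ₁ * (v - u)) := by ring
        _ ≤ τ₂ * (t - s) := by gcongr
    obtain ⟨s', hs', t', ht', hbs', hsu, hut, hts, hd'⟩ := exists_gap hB hpB.left_mem hs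
      (by linarith) hus fun huB => hne u hu u huB rfl
    refine ⟨s', t', ⟨hs', ht', hu, hv, hbs', by linarith, hau, hva, hsu.le, hut.le,
      by linarith, hd', hdA⟩, ?_⟩
    have hg := hpB.gap_le s' hs' t' ht' s hs t ht hbs' (by linarith) hts (by linarith) htb hd' hdB
    by_contra! hcon
    rw [min_eq_right hcon] at hg
    linarith

theorem isCompact_setOf_isLinkedGapPair {A B : Set ℝ} (hA : IsClosed A) (hB : IsClosed B)
    (a a' b b' : ℝ) :
    IsCompact {p : (ℝ × ℝ) × (ℝ × ℝ) |
      IsLinkedGapPair A B a a' b b' p.1.1 p.1.2 p.2.1 p.2.2} := by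
  have hK : IsCompact ((Set.Icc a a' ×ˢ Set.Icc a a') ×ˢ (Set.Icc b b' ×ˢ Set.Icc b b')) :=
    (isCompact_Icc.prod isCompact_Icc).prod (isCompact_Icc.prod isCompact_Icc)
  refine hK.of_isClosed_subset ?_ ?_
  · have : {p : (ℝ × ℝ) × (ℝ × ℝ) | IsLinkedGapPair A B a a' b b' p.1.1 p.1.2 p.2.1 p.2.2} =
        {p | p.1.1 ∈ A} ∩ {p | p.1.2 ∈ A} ∩ {p | p.2.1 ∈ B} ∩ {p | p.2.2 ∈ B} ∩
        {p | a ≤ p.1.1} ∩ {p | p.1.2 ≤ a'} ∩ {p | b ≤ p.2.1} ∩ {p | p.2.2 ≤ b'} ∩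
        {p | p.1.1 ≤ p.2.1} ∩ {p | p.2.1 ≤ p.1.2} ∩ {p | p.1.2 ≤ p.2.2} ∩
        {p | Disjoint (Set.Ioo p.1.1 p.1.2) A} ∩ {p | Disjoint (Set.Ioo p.2.1 p.2.2) B} := by
      ext p
      constructor
      · rintro ⟨h1, h2, h3, h4, h5, h6, h7, h8, h9, h10, h11, h12, h13⟩
        exact ⟨⟨⟨⟨⟨⟨⟨⟨⟨⟨⟨⟨h1, h2⟩, h3⟩, h4⟩, h5⟩, h6⟩, h7⟩, h8⟩, h9⟩, h10⟩, h11⟩, h12⟩, h13⟩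
      · rintro ⟨⟨⟨⟨⟨⟨⟨⟨⟨⟨⟨⟨h1, h2⟩, h3⟩, h4⟩, h5⟩, h6⟩, h7⟩, h8⟩, h9⟩, h10⟩, h11⟩, h12⟩, h13⟩
        exact ⟨h1, h2, h3, h4, h5, h6, h7, h8, h9, h10, h11, h12, h13⟩
    rw [this]
    refine IsClosed.inter (IsClosed.inter (IsClosed.inter (IsClosed.inter (IsClosed.inter
      (IsClosed.inter (IsClosed.inter (IsClosed.inter (IsClosed.inter (IsClosed.inter
      (IsClosed.inter (IsClosed.inter ?_ ?_) ?_) ?_) ?_) ?_) ?_) ?_) ?_) ?_) ?_) ?_) ?_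
    · exact hA.preimage (by fun_prop)
    · exact hA.preimage (by fun_prop)
    · exact hB.preimage (by fun_prop)
    · exact hB.preimage (by fun_prop)
    · exact isClosed_le (by fun_prop) (by fun_prop)
    · exact isClosed_le (by fun_prop) (by fun_prop)
    · exact isClosed_le (by fun_prop) (by fun_prop)
    · exact isClosed_le (by fun_prop) (by fun_prop)
    · exact isClosed_le (by fun_prop) (by fun_prop)
    · exact isClosed_le (by fun_prop) (by fun_prop)
    · exact isClosed_le (by fun_prop) (by fun_prop)
    · exact (isClosed_setOf_disjoint_Ioo A).preimage continuous_fst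
    · exact (isClosed_setOf_disjoint_Ioo B).preimage continuous_snd
  · rintro ⟨⟨u, v⟩, ⟨s, t⟩⟩ ⟨h1, h2, h3, h4, h5, h6, h7, h8, h9, h10, h11, h12, h13⟩
    dsimp only at *
    exact ⟨⟨⟨h5, by linarith⟩, ⟨by linarith, h6⟩⟩, ⟨⟨h7, by linarith⟩, ⟨by linarith, h8⟩⟩⟩

/-- Two thick pieces with a linked pair of gaps intersect. -/
theorem IsLinkedGapPair.not_disjoint {A B : Set ℝ} (hA : IsClosed A) (hB : IsClosed B)
    {τ₁ τ₂ a a' b b' u v s t : ℝ} (hτ₁ : 0 < τ₁) (hτ₂ : 0 < τ₂) (hτ : 1 < τ₁ * τ₂)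
    (hpA : IsThickPiece A τ₁ a a') (hpB : IsThickPiece B τ₂ b b')
    (h : IsLinkedGapPair A B a a' b b' u v s t) : ¬ Disjoint A B := by
  intro hd
  let K : Set ((ℝ × ℝ) × (ℝ × ℝ)) :=
    {p | IsLinkedGapPair A B a a' b b' p.1.1 p.1.2 p.2.1 p.2.2} ∪
      Prod.swap '' {p | IsLinkedGapPair B A b b' a a' p.1.1 p.1.2 p.2.1 p.2.2}
  have hK : IsCompact K := (isCompact_setOf_isLinkedGapPair hA hB a a' b b').union
    ((isCompact_setOf_isLinkedGapPair hB hA b b' a a').image continuous_swap)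
  -- A linked pair of least total length, over both orders of linking, contradicts `exists_smaller`.
  obtain ⟨⟨⟨u₀, v₀⟩, ⟨s₀, t₀⟩⟩, hmem, hmin⟩ := hK.exists_isMinOn ⟨((u, v), (s, t)), Or.inl h⟩
    (f := fun p => (p.1.2 - p.1.1) + (p.2.2 - p.2.1)) (by fun_prop)
  have hmin₁ : ∀ u v s t, IsLinkedGapPair A B a a' b b' u v s t →
      (v₀ - u₀) + (t₀ - s₀) ≤ (v - u) + (t - s) := fun u v s t h =>
    hmin (show ((u, v), (s, t)) ∈ K from Or.inl h)
  have hmin₂ : ∀ u v s t, IsLinkedGapPair B A b b' a a' s t u v →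
      (v₀ - u₀) + (t₀ - s₀) ≤ (v - u) + (t - s) := fun u v s t h =>
    hmin (show ((u, v), (s, t)) ∈ K from Or.inr ⟨((s, t), (u, v)), h, rfl⟩)
  rcases hmem with hmem | ⟨⟨⟨s₁, t₁⟩, ⟨u₁, v₁⟩⟩, hmem, heq⟩
  · rcases hmem.exists_smaller hA hB hτ₁ hτ hpA hpB hd with ⟨u', v', h', hlt⟩ | ⟨s', t', h', hlt⟩
    · have := hmin₂ _ _ _ _ h'
      dsimp only at hlt
      linarith
    · have := hmin₂ _ _ _ _ h'
      dsimp only at hlt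
      linarith
  · simp only [Prod.swap_prod_mk, Prod.mk.injEq] at heq
    obtain ⟨⟨rfl, rfl⟩, ⟨rfl, rfl⟩⟩ := heq
    rcases hmem.exists_smaller hB hA hτ₂ (by rwa [mul_comm]) hpB hpA hd.symm with
      ⟨u', v', h', hlt⟩ | ⟨s', t', h', hlt⟩
    · have := hmin₁ _ _ _ _ h'
      dsimp only at hlt
      linarith
    · have := hmin₁ _ _ _ _ h'
      dsimp only at hlt
      linarith

/-- If disjoint, `b` lies in a gap `(u, v)` of `A`. Being so near the end `a`, this gap is shorter
than `b' - b`, so `v` falls in a gap of `B` and the two gaps are linked. -/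
theorem IsThickPiece.not_disjoint_of_le {A B : Set ℝ} (hA : IsClosed A) (hB : IsClosed B)
    {τ₁ τ₂ a a' b b' : ℝ} (hτ₁ : 0 < τ₁) (hτ₂ : 0 < τ₂) (hτ : 1 < τ₁ * τ₂)
    (hpA : IsThickPiece A τ₁ a a') (hpB : IsThickPiece B τ₂ b b')
    (hab : a ≤ b) (h₁ : b - a ≤ a' - a) (h₂ : b - a < τ₁ * (b' - b)) : ¬ Disjoint A B := by
  intro hd
  have hne : ∀ x ∈ A, ∀ y ∈ B, x ≠ y := fun x hx y hy h => Set.disjoint_left.mp hd hx (h ▸ hy)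
  obtain ⟨u, hu, v, hv, hau, hub, hbv, hva, hdA⟩ := exists_gap hA hpA.left_mem hpA.right_mem
    hab (by linarith) fun h => hne b h b hpB.left_mem rfl
  have h3 := hpA.left_le u hu v hv hau (hub.trans hbv) hva hdA
  have h4 : v - u < b' - b := lt_of_mul_lt_mul_left (by linarith) hτ₁.le
  obtain ⟨s, hs, t, ht, hbs, hsv, hvt, htb, hdB⟩ := exists_gap hB hpB.left_mem hpB.right_mem
    hbv.le (by linarith) fun h => hne v hv v h rfl
  exact IsLinkedGapPair.not_disjoint hA hB hτ₁ hτ₂ hτ hpA hpB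
    ⟨hu, hv, hs, ht, hau, hva, hbs, htb, by linarith, hsv.le, hvt.le, hdA, hdB⟩ hd

/-- Two thick pieces whose left end points nearly coincide intersect. -/
theorem IsThickPiece.not_disjoint {A B : Set ℝ} (hA : IsClosed A) (hB : IsClosed B)
    {τ₁ τ₂ a a' b b' : ℝ} (hτ₁ : 0 < τ₁) (hτ₂ : 0 < τ₂) (hτ : 1 < τ₁ * τ₂)
    (hpA : IsThickPiece A τ₁ a a') (hpB : IsThickPiece B τ₂ b b')
    (h₁ : |b - a| < a' - a) (h₂ : |b - a| < b' - b)
    (h₃ : |b - a| < τ₁ * (b' - b)) (h₄ : |b - a| < τ₂ * (a' - a)) : ¬ Disjoint A B := by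
  rcases le_total a b with h | h
  · rw [abs_of_nonneg (by linarith)] at *
    exact IsThickPiece.not_disjoint_of_le hA hB hτ₁ hτ₂ hτ hpA hpB h h₁.le h₃
  · rw [abs_of_nonpos (by linarith)] at *
    exact fun hd => IsThickPiece.not_disjoint_of_le hB hA hτ₂ hτ₁ (by rwa [mul_comm]) hpB hpA h
      (by linarith) (by linarith) hd.symm

/-! ### Circles meeting a product of thick pieces -/

/-- If `p` and `q` are left end points of thick pieces, then the circles of radius `t` around `x`,
for `x` near `(x₁, x₂)` and `t` near the distance of `(x₁, x₂)` and `(p, q)`, meet `C₁ × C₂` near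
`(p, q)`. -/
theorem eventually_exists_sq_add_sq_eq {C₁ C₂ : Set ℝ} (hC₁ : IsClosed C₁) (hC₂ : IsClosed C₂)
    {τ₁ τ₂ : ℝ} (hτ₁ : 0 < τ₁) (hτ₂ : 0 < τ₂) (hτ : 1 < τ₁ * τ₂) {x₁ x₂ p p' q q' t₀ : ℝ}
    (hp : IsThickPiece C₁ τ₁ p p') (hq : IsThickPiece C₂ τ₂ q q') (hxp : x₁ < p) (hxq : q < x₂)
    (ht₀ : t₀ ^ 2 = (p - x₁) ^ 2 + (x₂ - q) ^ 2) {η : ℝ} (hη : 0 < η) :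
    ∀ᶠ z : (ℝ × ℝ) × ℝ in 𝓝 ((x₁, x₂), t₀), ∃ a ∈ C₁, ∃ b ∈ C₂, |a - p| < η ∧ |b - q| < η ∧
      (a - z.1.1) ^ 2 + (b - z.1.2) ^ 2 = z.2 ^ 2 := by
  -- `l` is the loss of thickness that can be afforded; the pieces are then shortened until the
  -- slopes of the two quadratic maps vary by a factor of at most `1 / l`.
  obtain ⟨l, hl, hl0, hl1⟩ : ∃ l : ℝ, 1 < (l * τ₁) * (l * τ₂) ∧ 0 < l ∧ l < 1 := by
    have h1 : Tendsto (fun l : ℝ => (l * τ₁) * (l * τ₂)) (𝓝 1) (𝓝 ((1 * τ₁) * (1 * τ₂))) :=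
      Continuous.tendsto (by fun_prop) 1
    have h2 := h1.eventually_const_lt (u := 1) (by simpa using hτ)
    have h3 : ∀ᶠ l : ℝ in 𝓝 1, 0 < l := lt_mem_nhds one_pos
    have h4 : ∀ᶠ l : ℝ in 𝓝[<] 1, l < 1 := self_mem_nhdsWithin
    exact (((h2.and h3).filter_mono nhdsWithin_le_nhds).and h4).exists.imp
      fun l h => ⟨h.1.1, h.1.2, h.2⟩
  obtain ⟨p₁, -, hp₁, hpp⟩ := hp.exists_short_left hC₁ hτ₁
    (η := min η ((p - x₁) * (1 - l))) (lt_min hη (mul_pos (by linarith) (by linarith)))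
  obtain ⟨q₁, -, hq₁, hqq⟩ := hq.exists_short_left hC₂ hτ₂
    (η := min η ((x₂ - q) * (1 - l))) (lt_min hη (mul_pos (by linarith) (by linarith)))
  have hpη : p₁ < p + η := hp₁.trans_le (by gcongr; exact min_le_left _ _)
  have hqη : q₁ < q + η := hq₁.trans_le (by gcongr; exact min_le_left _ _)
  have hpl : p₁ < p + (p - x₁) * (1 - l) := hp₁.trans_le (by gcongr; exact min_le_right _ _)
  have hql : q₁ < q + (x₂ - q) * (1 - l) := hq₁.trans_le (by gcongr; exact min_le_right _ _)
  have hpp' := hpp.lt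
  have hqq' := hqq.lt
  have hxp0 : 0 < (p - x₁) * l := mul_pos (by linarith) hl0
  have hxq0 : 0 < (x₂ - q) * l := mul_pos (by linarith) hl0
  -- All hypotheses of the gap lemma are strict inequalities, hence need checking only at the base
  -- point, where the left end points of the two images agree (`hD`).
  have hpos : ∀ {f g : (ℝ × ℝ) × ℝ → ℝ}, Continuous f → Continuous g →
      f ((x₁, x₂), t₀) < g ((x₁, x₂), t₀) → ∀ᶠ z in 𝓝 ((x₁, x₂), t₀), f z < g z :=
    fun hf hg h => hf.continuousAt.eventually_lt hg.continuousAt h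
  have hD : |(t₀ ^ 2 - (x₂ - q) ^ 2) - (p - x₁) ^ 2| = 0 := by
    rw [ht₀]; simp
  have hf0 : 0 < (p₁ - x₁) ^ 2 - (p - x₁) ^ 2 := by
    have : 0 < (p₁ - p) * (p₁ - x₁ + (p - x₁)) := mul_pos (by linarith) (by linarith)
    linarith
  have hql' : q₁ < x₂ := by linarith
  have hg0 : 0 < (x₂ - q) ^ 2 - (x₂ - q₁) ^ 2 := by
    have : 0 < (q₁ - q) * (x₂ - q + (x₂ - q₁)) := mul_pos (by linarith) (by linarith)
    linarith
  have e1 := hpos (f := fun z => l * (2 * (p₁ - z.1.1))) (g := fun z => 2 * (p - z.1.1))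
    (by fun_prop) (by fun_prop) (by
      dsimp only
      have : l * (p₁ - x₁) ≤ 1 * (p₁ - x₁) * l := by linarith
      have h1 : (p - x₁) * (1 - l) * l < (p - x₁) * (1 - l) :=
        mul_lt_of_lt_one_right (mul_pos (by linarith) (by linarith)) hl1
      have h2 : (p₁ - p) * l < (p - x₁) * (1 - l) * l := by gcongr; linarith
      linarith)
  have e2 := hpos (f := fun z => l * (2 * (z.1.2 - q))) (g := fun z => 2 * (z.1.2 - q₁))
    (by fun_prop) (by fun_prop) (by dsimp only; linarith)
  have e3 := hpos (f := fun z => z.1.1) (g := fun _ => p) (by fun_prop) (by fun_prop) hxp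
  have e4 := hpos (f := fun _ => q₁) (g := fun z => z.1.2) (by fun_prop) (by fun_prop) hql'
  have e5 := hpos (f := fun z => |(z.2 ^ 2 - (z.1.2 - q) ^ 2) - (p - z.1.1) ^ 2|)
    (g := fun z => (p₁ - z.1.1) ^ 2 - (p - z.1.1) ^ 2) (by fun_prop) (by fun_prop)
    (by dsimp only; rw [hD]; exact hf0)
  have e6 := hpos (f := fun z => |(z.2 ^ 2 - (z.1.2 - q) ^ 2) - (p - z.1.1) ^ 2|)
    (g := fun z => (z.2 ^ 2 - (z.1.2 - q₁) ^ 2) - (z.2 ^ 2 - (z.1.2 - q) ^ 2))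
    (by fun_prop) (by fun_prop) (by dsimp only; rw [hD]; linarith)
  have e7 := hpos (f := fun z => |(z.2 ^ 2 - (z.1.2 - q) ^ 2) - (p - z.1.1) ^ 2|)
    (g := fun z => l * τ₁ * ((z.2 ^ 2 - (z.1.2 - q₁) ^ 2) - (z.2 ^ 2 - (z.1.2 - q) ^ 2)))
    (by fun_prop) (by fun_prop)
    (by dsimp only; rw [hD]; exact mul_pos (mul_pos hl0 hτ₁) (by linarith))
  have e8 := hpos (f := fun z => |(z.2 ^ 2 - (z.1.2 - q) ^ 2) - (p - z.1.1) ^ 2|)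
    (g := fun z => l * τ₂ * ((p₁ - z.1.1) ^ 2 - (p - z.1.1) ^ 2)) (by fun_prop) (by fun_prop)
    (by dsimp only; rw [hD]; exact mul_pos (mul_pos hl0 hτ₂) hf0)
  filter_upwards [e1, e2, e3, e4, e5, e6, e7, e8] with z h1 h2 h3 h4 h5 h6 h7 h8
  obtain ⟨⟨y₁, y₂⟩, t⟩ := z
  dsimp only at *
  have hA := hpp.image (φ := fun a => (a - y₁) ^ 2) hτ₁ (m := 2 * (p - y₁)) (M := 2 * (p₁ - y₁))
    (by linarith) hl0 h1.le (fun x hx y hy hxy => by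
      have : 0 ≤ (y - x) * ((x - p) + (y - p)) :=
        mul_nonneg (by linarith) (by linarith [hx.1, hy.1])
      linarith) (fun x hx y hy hxy => by
      have : 0 ≤ (y - x) * ((p₁ - x) + (p₁ - y)) :=
        mul_nonneg (by linarith) (by linarith [hx.2, hy.2])
      linarith)
  have hB := hqq.image (φ := fun b => t ^ 2 - (y₂ - b) ^ 2) hτ₂ (m := 2 * (y₂ - q₁))
    (M := 2 * (y₂ - q)) (by linarith) hl0 h2.le (fun x hx y hy hxy => by
      have : 0 ≤ (y - x) * ((q₁ - x) + (q₁ - y)) :=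
        mul_nonneg (by linarith) (by linarith [hx.2, hy.2])
      linarith) (fun x hx y hy hxy => by
      have : 0 ≤ (y - x) * ((x - q) + (y - q)) :=
        mul_nonneg (by linarith) (by linarith [hx.1, hy.1])
      linarith)
  have hAc : IsClosed ((fun a => (a - y₁) ^ 2) '' (C₁ ∩ Set.Icc p p₁)) :=
    ((isCompact_Icc.inter_left hC₁).image (by fun_prop)).isClosed
  have hBc : IsClosed ((fun b => t ^ 2 - (y₂ - b) ^ 2) '' (C₂ ∩ Set.Icc q q₁)) :=
    ((isCompact_Icc.inter_left hC₂).image (by fun_prop)).isClosed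
  obtain ⟨w, ⟨a, ⟨haC, ha⟩, haw⟩, ⟨b, ⟨hbC, hb⟩, hbw⟩⟩ := Set.not_disjoint_iff.mp
    (hA.not_disjoint hAc hBc (mul_pos hl0 hτ₁) (mul_pos hl0 hτ₂) hl hB h5 h6 h7 h8)
  refine ⟨a, haC, b, hbC, abs_lt.mpr ⟨by linarith [ha.1], by linarith [ha.2]⟩,
    abs_lt.mpr ⟨by linarith [hb.1], by linarith [hb.2]⟩, ?_⟩
  dsimp only at haw hbw
  linarith

/-- Shortening from the right end brings the first piece near `x₁`; shortening from the left then
detaches its left end from `x₁`. -/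
theorem exists_near_end_points {C₁ C₂ : Set ℝ} (hC₁ : IsClosed C₁) (hC₂ : IsClosed C₂)
    {τ₁ τ₂ : ℝ} (hτ₁ : 0 < τ₁) (hτ₂ : 0 < τ₂) {x₁ y₁ x₂ y₂ : ℝ}
    (h₁ : IsThickPiece C₁ τ₁ x₁ y₁) (h₂ : IsThickPiece C₂ τ₂ y₂ x₂) {δ : ℝ} (hδ : 0 < δ) :
    ∃ p p' q, IsThickPiece C₁ τ₁ p p' ∧ IsThickPiece C₂ τ₂ q x₂ ∧ x₁ < p ∧ p < x₁ + δ ∧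
      x₂ - δ < q := by
  obtain ⟨p', -, hp', h₁'⟩ := h₁.exists_short_left hC₁ hτ₁ hδ
  obtain ⟨p, -, hp, h₁''⟩ := h₁'.exists_short_right hC₁ hτ₁ (sub_pos.mpr h₁'.lt)
  obtain ⟨q, -, hq, h₂'⟩ := h₂.exists_short_right hC₂ hτ₂ hδ
  exact ⟨p, p', q, h₁'', h₂', by linarith, by linarith [h₁''.lt], hq⟩

/-! ### From thickness to thick pieces on the line -/

/-- A point outside a compact set on the line is in a gap whose path component is an interval. -/
theorem pathComponentIn_compl_eq_image_Ioo {X : Type*} [MetricSpace X] (e : X ≃ᵢ ℝ) {C : Set X}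
    {u v w : ℝ} (hu : e.symm u ∈ C) (hv : e.symm v ∈ C) (huw : u < w) (hwv : w < v)
    (hd : Disjoint (Set.Ioo u v) {x | e.symm x ∈ C}) :
    pathComponentIn Cᶜ (e.symm w) = e.symm '' Set.Ioo u v := by
  have hsub : e.symm '' Set.Ioo u v ⊆ Cᶜ := by
    rintro _ ⟨x, hx, rfl⟩ hxC
    exact Set.disjoint_left.mp hd hx hxC
  have hw : e.symm w ∈ e.symm '' Set.Ioo u v := ⟨w, ⟨huw, hwv⟩, rfl⟩
  apply Set.Subset.antisymm
  · have hconn := ((isPathConnected_pathComponentIn (hsub hw)).isConnected.isPreconnected.image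
      e e.continuous.continuousOn).ordConnected
    have hwmem : w ∈ e '' pathComponentIn Cᶜ (e.symm w) :=
      ⟨_, mem_pathComponentIn_self (hsub hw), e.apply_symm_apply w⟩
    have hno : ∀ z, e.symm z ∈ C → z ∉ e '' pathComponentIn Cᶜ (e.symm w) := by
      rintro z hz ⟨y, hy, rfl⟩
      rw [e.symm_apply_apply] at hz
      exact pathComponentIn_subset hy hz
    intro y hy
    have hy' : e y ∈ e '' pathComponentIn Cᶜ (e.symm w) := ⟨y, hy, rfl⟩
    refine ⟨e y, ⟨?_, ?_⟩, e.symm_apply_apply y⟩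
    · by_contra! h
      exact hno u hu (hconn.out hy' hwmem ⟨h, huw.le⟩)
    · by_contra! h
      exact hno v hv (hconn.out hwmem hy' ⟨hwv.le, h⟩)
  · exact (((convex_Ioo u v).isPathConnected ⟨w, huw, hwv⟩).image
      e.symm.continuous).subset_pathComponentIn hw hsub

theorem mem_unboundedGap_of_Iio {X : Type*} [MetricSpace X] (e : X ≃ᵢ ℝ) {C : Set X} {a w : ℝ}
    (ha : ∀ x, e.symm x ∈ C → a ≤ x) (hw : w < a) : e.symm w ∈ unboundedGap C := by
  have hsub : e.symm '' Set.Iio a ⊆ Cᶜ := by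
    rintro _ ⟨x, hx, rfl⟩ hxC
    exact absurd (ha x hxC) (not_le.mpr hx)
  refine ⟨hsub ⟨w, hw, rfl⟩, fun hb => ?_⟩
  have h1 := hb.subset (((convex_Iio a).isPathConnected ⟨w, hw⟩).image
    e.symm.continuous |>.subset_pathComponentIn ⟨w, hw, rfl⟩ hsub)
  have h2 := e.isometry.lipschitz.isBounded_image h1
  rw [Set.image_image] at h2
  simp only [e.apply_symm_apply, Set.image_id'] at h2
  exact not_bddBelow_Iio a h2.bddBelow

theorem mem_unboundedGap_of_Ioi {X : Type*} [MetricSpace X] (e : X ≃ᵢ ℝ) {C : Set X} {b w : ℝ}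
    (hb : ∀ x, e.symm x ∈ C → x ≤ b) (hw : b < w) : e.symm w ∈ unboundedGap C := by
  have := mem_unboundedGap_of_Iio (e.trans (IsometryEquiv.neg ℝ)) (C := C) (a := -b) (w := -w)
    (fun x hx => by
      have := hb (-x) hx
      linarith) (by linarith)
  have h : (e.trans (IsometryEquiv.neg ℝ)).symm (-w) = e.symm w := by
    show e.symm (- -w) = e.symm w
    rw [neg_neg]
  rwa [h] at this

theorem le_ediam_of_image_Ioo_subset {X : Type*} [MetricSpace X] (e : X ≃ᵢ ℝ) {G : Set X} {u v : ℝ}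
    (h : e.symm '' Set.Ioo u v ⊆ G) : ENNReal.ofReal (v - u) ≤ Metric.ediam G := by
  rw [← Real.ediam_Ioo, ← e.symm.isometry.ediam_image]
  exact Metric.ediam_mono h

/-- A set of thickness `> τ` on the line contains a thick piece. -/
theorem exists_isThickPiece {X : Type*} [MetricSpace X] (e : X ≃ᵢ ℝ) {C : Set X}
    (hC : IsCompact C) {τ : ℝ} (hτ : 0 < τ) (h : ENNReal.ofReal τ < thickness C) :
    ∃ a b, IsThickPiece {x | e.symm x ∈ C} τ a b := by
  have hCc : IsCompact {x | e.symm x ∈ C} := by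
    have : {x | e.symm x ∈ C} = e '' C := by
      rw [← IsometryEquiv.preimage_symm]; rfl
    rw [this]
    exact hC.image e.continuous
  unfold thickness at h
  split_ifs at h with hg hi
  · obtain ⟨⟨r, hr⟩, hτr⟩ := lt_iSup_iff.mp h
    have hne : {x | e.symm x ∈ C}.Nonempty := by
      by_contra hemp
      rw [Set.not_nonempty_iff_eq_empty] at hemp
      have hC0 : C = ∅ := by
        rw [Set.eq_empty_iff_forall_notMem] at hemp ⊢
        intro x hx
        exact hemp (e x) (by simpa using hx)
      obtain ⟨G, x, hx, rfl, hb⟩ := hg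
      have hmem := mem_unboundedGap_of_Iio e (C := C) (a := e x + 1) (w := e x)
        (by simp [hC0]) (by linarith)
      rw [e.symm_apply_apply] at hmem
      exact hmem.2 hb
    obtain ⟨a, haC, ha⟩ := hCc.exists_isLeast hne
    obtain ⟨b, hbC, hb⟩ := hCc.exists_isGreatest hne
    have hsub : ∀ u v, Disjoint (Set.Ioo u v) {x | e.symm x ∈ C} → e.symm u ∈ C → e.symm v ∈ C →
        u < v → e.symm '' Set.Ioo u v ∈ boundedGaps C := by
      intro u v hd hu hv huv
      obtain ⟨w, huw, hwv⟩ := exists_between huv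
      refine ⟨e.symm w, fun hw => Set.disjoint_left.mp hd ⟨huw, hwv⟩ hw,
        (pathComponentIn_compl_eq_image_Ioo e hu hv huw hwv hd).symm, ?_⟩
      exact e.symm.isometry.lipschitz.isBounded_image (Metric.isBounded_Ioo u v)
    have hdist : ∀ u v (hd : e.symm '' Set.Ioo u v ∈ boundedGaps C), u < v → ∀ x ∈ Set.Ioo u v,
        ∀ y, (e.symm y ∈ (⋃ H : boundedGaps C, ⋃ _ : r H < r ⟨_, hd⟩, (H : Set X)) ∨
          e.symm y ∈ unboundedGap C) → τ * (v - u) ≤ |x - y| := by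
      intro u v hd huv x hx y hy
      have h1 := ENNReal.mul_le_of_le_div (hτr.le.trans (iInf_le _ ⟨_, hd⟩))
      have h2 := h1.trans ((iInf₂_le (e.symm x) ⟨x, hx, rfl⟩).trans (iInf₂_le (e.symm y) hy))
      have h3 := (mul_le_mul_right (le_ediam_of_image_Ioo_subset e subset_rfl) _).trans h2
      rw [e.symm.edist_eq, edist_dist, ← ENNReal.ofReal_mul hτ.le, Real.dist_eq,
        ENNReal.ofReal_le_ofReal_iff (abs_nonneg _)] at h3
      exact h3
    refine ⟨a, b, ?_, haC, hbC, ?_, ?_, ?_⟩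
    · obtain ⟨G, x, hx, rfl, hb'⟩ := hg
      have hx' : e.symm (e x) = x := e.symm_apply_apply x
      have h1 : a ≤ e x := by
        by_contra! hlt
        have := mem_unboundedGap_of_Iio e (fun x hx => ha hx) hlt
        rw [hx'] at this
        exact this.2 hb'
      have h2 : e x ≤ b := by
        by_contra! hlt
        have := mem_unboundedGap_of_Ioi e (fun x hx => hb hx) hlt
        rw [hx'] at this
        exact this.2 hb'
      refine lt_of_lt_of_le (lt_of_le_of_ne h1 fun h => hx ?_) h2
      rw [← hx', ← h]
      exact haC
    · intro u hu v hv hau huv hvb hd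
      -- The gaps are open, so their end points are only approached: one test point lies just inside
      -- the gap, the other just outside `[a, b]`.
      refine le_of_forall_pos_le_add fun ε hε => ?_
      have hpos : 0 < min ε (v - u) := lt_min hε (by linarith)
      have h1 := min_le_left ε (v - u)
      have h2 := min_le_right ε (v - u)
      have h3 := hdist u v (hsub u v hd hu hv huv) huv (u + min ε (v - u) / 2)
        ⟨by linarith, by linarith⟩ (a - min ε (v - u) / 2)
        (Or.inr (mem_unboundedGap_of_Iio e (fun x hx => ha hx) (by linarith)))
      rw [abs_of_nonneg (by linarith)] at h3
      linarith
    · intro u hu v hv hau huv hvb hd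
      refine le_of_forall_pos_le_add fun ε hε => ?_
      have hpos : 0 < min ε (v - u) := lt_min hε (by linarith)
      have h1 := min_le_left ε (v - u)
      have h2 := min_le_right ε (v - u)
      have h3 := hdist u v (hsub u v hd hu hv huv) huv (v - min ε (v - u) / 2)
        ⟨by linarith, by linarith⟩ (b + min ε (v - u) / 2)
        (Or.inr (mem_unboundedGap_of_Ioi e (fun x hx => hb hx) (by linarith)))
      rw [abs_of_nonpos (by linarith)] at h3
      linarith
    · intro u hu v hv s hs t ht hau huv hvs hst htb hd hd'
      refine le_of_forall_pos_le_add fun ε hε => ?_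
      obtain ⟨κ, hκ, hκε, hκu, hκs⟩ : ∃ κ > 0, κ ≤ ε / 2 ∧ κ < v - u ∧ κ < t - s := by
        obtain ⟨κ, hκ, h⟩ := exists_between (lt_min (half_pos hε)
          (lt_min (sub_pos.mpr huv) (sub_pos.mpr hst)))
        simp only [lt_min_iff] at h
        exact ⟨κ, hκ, h.1.le, h.2.1, h.2.2⟩
      have hG := hsub u v hd hu hv huv
      have hH := hsub s t hd' hs ht hst
      have hx : v - κ ∈ Set.Ioo u v := ⟨by linarith, by linarith⟩
      have hy : s + κ ∈ Set.Ioo s t := ⟨by linarith, by linarith⟩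
      have hmin₁ : τ * min (v - u) (t - s) ≤ τ * (v - u) :=
        mul_le_mul_of_nonneg_left (min_le_left _ _) hτ.le
      have hmin₂ : τ * min (v - u) (t - s) ≤ τ * (t - s) :=
        mul_le_mul_of_nonneg_left (min_le_right _ _) hτ.le
      -- The thickness bound is applied to whichever gap comes later in the ordering; the minimum in
      -- `gap_le` covers both cases.
      rcases lt_trichotomy (r ⟨_, hG⟩) (r ⟨_, hH⟩) with hlt | heq | hlt
      · have h3 := hdist s t hH hst (s + κ) hy (v - κ)
          (Or.inl (Set.mem_iUnion₂.mpr ⟨⟨_, hG⟩, hlt, _, hx, rfl⟩))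
        rw [abs_of_nonneg (by linarith)] at h3
        linarith
      · have h3 : e.symm '' Set.Ioo u v = e.symm '' Set.Ioo s t :=
          congrArg Subtype.val (hr.1 heq)
        have h4 : v - κ ∈ Set.Ioo s t :=
          e.symm.injective.mem_set_image.mp (h3 ▸ ⟨_, hx, rfl⟩)
        linarith [h4.1]
      · have h3 := hdist u v hG huv (v - κ) hx (s + κ)
          (Or.inl (Set.mem_iUnion₂.mpr ⟨⟨_, hH⟩, hlt, _, hy, rfl⟩))
        rw [abs_of_nonpos (by linarith)] at h3
        linarith
  · obtain ⟨x, hx⟩ := hi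
    have hx' : e.symm ⁻¹' (interior C) ∈ 𝓝 (e x) :=
      (isOpen_interior.preimage e.symm.continuous).mem_nhds (by simpa using hx)
    obtain ⟨ε, hε, hball⟩ := Metric.mem_nhds_iff.mp hx'
    have hmem : ∀ y ∈ Set.Icc (e x) (e x + ε / 2), e.symm y ∈ C := fun y hy =>
      interior_subset (hball (by
        rw [Metric.mem_ball, Real.dist_eq, abs_lt]
        exact ⟨by linarith [hy.1], by linarith [hy.2]⟩))
    have hno : ∀ u v, e x ≤ u → u < v → v ≤ e x + ε / 2 →
        Disjoint (Set.Ioo u v) {x | e.symm x ∈ C} → False := by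
      intro u v hu huv hv hd
      obtain ⟨w, huw, hwv⟩ := exists_between huv
      exact Set.disjoint_left.mp hd ⟨huw, hwv⟩ (hmem w ⟨by linarith, by linarith⟩)
    exact ⟨e x, e x + ε / 2, by linarith, hmem _ ⟨le_rfl, by linarith⟩,
      hmem _ ⟨by linarith, le_rfl⟩,
      fun u _ v _ h1 h2 h3 h4 => (hno u v h1 h2 h3 h4).elim,
      fun u _ v _ h1 h2 h3 h4 => (hno u v h1 h2 h3 h4).elim,
      fun u _ v _ s _ t _ h1 h2 h3 h4 h5 h6 _ => (hno u v h1 h2 (by linarith) h6).elim⟩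
  · exact absurd h (not_lt.mpr zero_le)

/-! ### Dimension at least two -/

/-- In dimension `≥ 2`, every small sphere around a point of the frontier of an unbounded component
of the complement of a bounded open connected set `G` meets this frontier. -/
theorem exists_subset_frontier_forall_exists_dist_eq {E : Type*} [NormedAddCommGroup E]
    [NormedSpace ℝ E] (hE : 1 < Module.rank ℝ E) {G : Set E} (hGo : IsOpen G)
    (hGc : IsPreconnected G) (hGn : G.Nonempty) (hGb : Bornology.IsBounded G) :
    ∃ K : Set E, K ⊆ frontier G ∧ K.Nonempty ∧ ∃ ρ > (0 : ℝ), ∀ y ∈ K, ∀ r ∈ Set.Ioo 0 ρ,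
      ∃ y' ∈ K, dist y y' = r := by
  have : Nontrivial E := rank_pos_iff_nontrivial.mp (zero_lt_one.trans hE)
  obtain ⟨e, he⟩ := exists_norm_eq E zero_le_one
  obtain ⟨R, hR⟩ := hGb.closure.exists_norm_le
  set O : Set E := (closure G)ᶜ with hO
  have hOo : IsOpen O := isClosed_closure.isOpen_compl
  have hray : ∀ s ∈ Set.Ioi (max R 0), s • e ∈ O := by
    intro s hs hmem
    have := hR _ hmem
    rw [norm_smul, he, mul_one, Real.norm_eq_abs] at this
    exact absurd ((le_abs_self s).trans this) (not_le.mpr ((le_max_left _ _).trans_lt hs))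
  set z : E := (max R 0 + 1) • e with hz
  have hzO : z ∈ O := hray _ (by simp)
  set W := pathComponentIn O z with hW
  have hWO : W ⊆ O := pathComponentIn_subset
  have hWo : IsOpen W := hOo.pathComponentIn z
  have hWc : IsPreconnected W := (isPathConnected_pathComponentIn hzO).isConnected.isPreconnected
  have hrayW : ∀ s ∈ Set.Ioi (max R 0), s • e ∈ W := by
    have h1 : IsPathConnected ((fun s : ℝ => s • e) '' Set.Ioi (max R 0)) :=
      ((convex_Ioi _).isPathConnected ⟨max R 0 + 1, by simp⟩).image (by fun_prop)
    intro s hs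
    refine h1.subset_pathComponentIn ⟨max R 0 + 1, by simp, rfl⟩ ?_ ⟨s, hs, rfl⟩
    rintro _ ⟨s, hs, rfl⟩
    exact hray s hs
  have hfrO : ∀ y ∈ frontier W, y ∉ O := by
    intro y hy hyO
    have h1 : IsOpen (pathComponentIn O y) := hOo.pathComponentIn y
    obtain ⟨w, hw₁, hw₂⟩ := mem_closure_iff.mp (frontier_subset_closure hy) _ h1
      (mem_pathComponentIn_self hyO)
    have h2 : y ∈ W := by
      rw [hW, ← pathComponentIn_congr hw₂, pathComponentIn_congr hw₁]
      exact mem_pathComponentIn_self hyO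
    rw [hWo.frontier_eq] at hy
    exact hy.2 h2
  have hGW : Disjoint G W := Set.disjoint_left.mpr fun x hx hxW => hWO hxW (subset_closure hx)
  have hfrG : ∀ y ∈ frontier W, y ∈ closure G := fun y hy => not_not.mp (hfrO y hy)
  have hfr : frontier W ⊆ frontier G := by
    intro y hy
    rw [hGo.frontier_eq]
    refine ⟨hfrG y hy, fun hyG => ?_⟩
    obtain ⟨w, hw₁, hw₂⟩ := mem_closure_iff.mp (frontier_subset_closure hy) G hGo hyG
    exact Set.disjoint_left.mp hGW hw₁ hw₂
  -- Applied to `W` and to `G`: a small sphere about `y` meets both, and being connected it cannot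
  -- pass from `W` to `G` without crossing `frontier W`.
  have hmeet : ∀ A : Set E, IsPreconnected A → ∀ y ∈ closure A, ∀ r : ℝ, 0 < r →
      (∃ a ∈ A, r ≤ dist a y) → (A ∩ Metric.sphere y r).Nonempty := by
    intro A hA y hy r hr ⟨a, haA, ha⟩
    obtain ⟨w, hw, hwA⟩ := mem_closure_iff.mp hy _ Metric.isOpen_ball (Metric.mem_ball_self hr)
    obtain ⟨x, hx, hxr⟩ := hA.intermediate_value hwA haA (f := fun x => dist x y)
      (by fun_prop) ⟨(Metric.mem_ball.mp hw).le, ha⟩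
    exact ⟨x, hx, hxr⟩
  obtain ⟨g, hg⟩ := hGn
  obtain ⟨g', hg', hgg'⟩ : ∃ g' ∈ G, g' ≠ g := by
    have := Module.punctured_nhds_neBot ℝ E g
    obtain ⟨g', h1, h2⟩ := (((eventually_mem_nhdsWithin (a := g) (s := {g}ᶜ))).and
      (nhdsWithin_le_nhds (hGo.mem_nhds hg))).exists
    exact ⟨g', h2, h1⟩
  -- No ball of radius below `dist g g' / 2` contains both `g` and `g'`, so `G` reaches every sphere
  -- considered.
  refine ⟨frontier W, hfr, ?_, dist g g' / 2, half_pos (dist_pos.mpr hgg'.symm), ?_⟩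
  · rw [nonempty_frontier_iff]
    exact ⟨⟨z, mem_pathComponentIn_self hzO⟩, fun h =>
      Set.disjoint_left.mp hGW hg (h ▸ Set.mem_univ g)⟩
  · intro y hy r hr
    obtain ⟨x₁, hx₁W, hx₁⟩ := hmeet W hWc y (frontier_subset_closure hy) r hr.1 (by
      refine ⟨(max R 0 + 1 + r + ‖y‖) • e, hrayW _ ?_, ?_⟩
      · have := norm_nonneg y
        have := hr.1
        simp only [Set.mem_Ioi]
        linarith
      · have h0 : 0 ≤ max R 0 := le_max_right _ _
        have h1 := norm_sub_norm_le ((max R 0 + 1 + r + ‖y‖) • e) y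
        rw [norm_smul, he, mul_one, Real.norm_eq_abs, ← dist_eq_norm] at h1
        have h2 := le_abs_self (max R 0 + 1 + r + ‖y‖)
        linarith)
    obtain ⟨x₂, hx₂G, hx₂⟩ := hmeet G hGc y (hfrG y hy) r hr.1 (by
      by_contra! hcon
      have h1 := hcon g hg
      have h2 := hcon g' hg'
      have h3 := dist_triangle_right g g' y
      linarith [hr.2])
    have hsph := isPreconnected_sphere hE y r
    by_contra! hcon
    obtain ⟨x, -, hxW, hxW'⟩ := hsph W (closure W)ᶜ hWo isClosed_closure.isOpen_compl
      (fun x hx => by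
        by_contra! hx'
        simp only [Set.mem_union, Set.mem_compl_iff, not_or, not_not] at hx'
        refine hcon x ?_ (by rw [dist_comm]; exact hx)
        rw [hWo.frontier_eq]
        exact ⟨hx'.2, hx'.1⟩) ⟨x₁, hx₁, hx₁W⟩
      ⟨x₂, hx₂, fun h => Set.disjoint_left.mp (hGW.closure_right hGo) hx₂G h⟩
    exact hxW' (subset_closure hxW)

theorem exists_subset_forall_exists_dist_eq {E : Type*} [NormedAddCommGroup E]
    [NormedSpace ℝ E] (hE : 1 < Module.rank ℝ E) {C : Set E} (hC : IsClosed C)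
    (h : thickness C ≠ 0) :
    ∃ K : Set E, K ⊆ C ∧ K.Nonempty ∧ ∃ ρ > (0 : ℝ), ∀ y ∈ K, ∀ r ∈ Set.Ioo 0 ρ,
      ∃ y' ∈ K, dist y y' = r := by
  have : Nontrivial E := rank_pos_iff_nontrivial.mp (zero_lt_one.trans hE)
  unfold thickness at h
  split_ifs at h with hg hi
  · obtain ⟨G, x, hx, rfl, hb⟩ := hg
    have hopen : IsOpen (pathComponentIn Cᶜ x) := hC.isOpen_compl.pathComponentIn x
    obtain ⟨K, hK, h⟩ := exists_subset_frontier_forall_exists_dist_eq hE hopen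
      (isPathConnected_pathComponentIn hx).isConnected.isPreconnected
      ⟨x, mem_pathComponentIn_self hx⟩ hb
    refine ⟨K, hK.trans fun y hy => ?_, h⟩
    by_contra hyC
    obtain ⟨w, hw₁, hw₂⟩ := mem_closure_iff.mp (frontier_subset_closure hy) _
      (hC.isOpen_compl.pathComponentIn y) (mem_pathComponentIn_self hyC)
    rw [hopen.frontier_eq] at hy
    refine hy.2 ?_
    rw [← pathComponentIn_congr hw₂, pathComponentIn_congr hw₁]
    exact mem_pathComponentIn_self hyC
  · obtain ⟨p, hp⟩ := hi
    obtain ⟨ρ, hρ, hball⟩ := Metric.nhds_basis_closedBall.mem_iff.mp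
      (mem_interior_iff_mem_nhds.mp hp)
    obtain ⟨e, he⟩ := exists_norm_eq E zero_le_one
    refine ⟨Metric.closedBall p ρ, hball, ⟨p, Metric.mem_closedBall_self hρ.le⟩, ρ, hρ, ?_⟩
    intro y hy r hr
    obtain ⟨w, hw, hyw⟩ : ∃ w : E, ‖w‖ = 1 ∧ y - p = ‖y - p‖ • w := by
      rcases eq_or_ne (y - p) 0 with h0 | h0
      · exact ⟨e, he, by simp [h0]⟩
      · exact ⟨‖y - p‖⁻¹ • (y - p), by simp [norm_smul, norm_ne_zero_iff.mpr h0],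
          by rw [smul_smul, mul_inv_cancel₀ (norm_ne_zero_iff.mpr h0), one_smul]⟩
    -- Moving a distance `r < ρ` towards the centre, possibly past it, stays in the ball.
    refine ⟨y - r • w, ?_, ?_⟩
    · rw [Metric.mem_closedBall, dist_eq_norm] at hy ⊢
      have h1 : y - r • w - p = (‖y - p‖ - r) • w := by
        rw [sub_smul, ← hyw]; abel
      rw [h1, norm_smul, hw, mul_one, Real.norm_eq_abs, abs_le]
      exact ⟨by linarith [norm_nonneg (y - p), hr.2], by linarith [hr.1]⟩
    · rw [dist_eq_norm, sub_sub_cancel, norm_smul, hw, mul_one, Real.norm_of_nonneg hr.1.le]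
  · exact absurd rfl h

theorem nonempty_of_thickness_ne_zero {E : Type*} [NormedAddCommGroup E]
    [NormedSpace ℝ E] [Nontrivial E] {C : Set E} (h : thickness C ≠ 0) : C.Nonempty := by
  rw [Set.nonempty_iff_ne_empty]
  rintro rfl
  unfold thickness at h
  split_ifs at h with hg hi
  · obtain ⟨G, x, hx, rfl, hb⟩ := hg
    exact NormedSpace.unbounded_univ ℝ E
      (hb.subset (isPathConnected_univ.subset_pathComponentIn (Set.mem_univ x) (by simp)))
  · simp at hi
  · exact h rfl

/-- The slice `K × {q}` is isometric to `K`, so a single state with a principal filter suffices; of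
`C₂` only a point is used. -/
theorem interior_graphDistanceSet_euclideanProd_nonempty_of_two_le {d : ℕ} (hd : 2 ≤ d)
    (C₁ C₂ : Set (EuclideanSpace ℝ (Fin d))) (hC₁ : IsClosed C₁)
    (h₁ : thickness C₁ ≠ 0) (h₂ : thickness C₂ ≠ 0)
    {V : Type*} [Finite V] {T : SimpleGraph V} (hT : T.IsTree) :
    (interior (graphDistanceSet T (euclideanProd C₁ C₂))).Nonempty := by
  have hrank : 1 < Module.rank ℝ (EuclideanSpace ℝ (Fin d)) := by
    rw [← Module.finrank_eq_rank, finrank_euclideanSpace_fin]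
    exact_mod_cast hd
  have : Nontrivial (EuclideanSpace ℝ (Fin d)) :=
    rank_pos_iff_nontrivial.mp (zero_lt_one.trans hrank)
  obtain ⟨K, hKC, hKn, ρ, hρ, hK⟩ := exists_subset_forall_exists_dist_eq hrank hC₁ h₁
  obtain ⟨q, hq⟩ := nonempty_of_thickness_ne_zero h₂
  let ι : EuclideanSpace ℝ (Fin d) →
      WithLp 2 (EuclideanSpace ℝ (Fin d) × EuclideanSpace ℝ (Fin d)) := fun x => WithLp.toLp 2 (x, q)
  have hι : ∀ x y, dist (ι x) (ι y) = dist x y := fun x y => by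
    rw [WithLp.prod_dist_eq_of_L2]
    simp [ι, Real.sqrt_sq dist_nonneg]
  have hne : ∀ _ : Unit, (𝓟 (ι '' K)).NeBot := fun _ => principal_neBot_iff.mpr (hKn.image ι)
  refine interior_graphDistanceSet_nonempty (S := Unit) (fun _ => 𝓟 (ι '' K)) hne ?_ ?_ hT
  · rintro -
    rw [mem_principal]
    rintro _ ⟨x, hx, rfl⟩
    exact ⟨hKC hx, hq⟩
  · rintro - δ hδ
    refine ⟨(), min δ ρ / 2, by positivity, fun A' hA' => ⟨ι '' K, mem_principal_self _,
      min δ ρ / 2, min δ ρ, le_rfl, half_lt_self (by positivity), min_le_left _ _, ?_⟩⟩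
    rintro _ ⟨x, hx, rfl⟩ t ht
    obtain ⟨y, hy, hxy⟩ := hK x hx t
      ⟨lt_trans (by positivity) ht.1, ht.2.trans_le (min_le_right _ _)⟩
    exact ⟨ι y, hA' ⟨y, hy, rfl⟩, by rw [hι, hxy]⟩

/-! ### Dimension one and conclusion -/

theorem interior_graphDistanceSet_euclideanProd_nonempty_of_isThickPiece
    (e : EuclideanSpace ℝ (Fin 1) ≃ᵢ ℝ) {C₁ C₂ : Set (EuclideanSpace ℝ (Fin 1))}
    (hC₁ : IsClosed C₁) (hC₂ : IsClosed C₂) {τ₁ τ₂ : ℝ} (hτ₁ : 0 < τ₁) (hτ₂ : 0 < τ₂)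
    (hτ : 1 < τ₁ * τ₂) {a₁ b₁ a₂ b₂ : ℝ} (h₁ : IsThickPiece {x | e.symm x ∈ C₁} τ₁ a₁ b₁)
    (h₂ : IsThickPiece {x | e.symm x ∈ C₂} τ₂ a₂ b₂)
    {V : Type*} [Finite V] {T : SimpleGraph V} (hT : T.IsTree) :
    (interior (graphDistanceSet T (euclideanProd C₁ C₂))).Nonempty := by
  set D₁ : Set ℝ := {x | e.symm x ∈ C₁} with hD₁
  set D₂ : Set ℝ := {x | e.symm x ∈ C₂} with hD₂
  have hD₁c : IsClosed D₁ := hC₁.preimage e.symm.continuous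
  have hD₂c : IsClosed D₂ := hC₂.preimage e.symm.continuous
  let mk : ℝ × ℝ → WithLp 2 (EuclideanSpace ℝ (Fin 1) × EuclideanSpace ℝ (Fin 1)) :=
    fun w => WithLp.toLp 2 (e.symm w.1, e.symm w.2)
  have hmk : Continuous mk := (WithLp.prod_continuous_toLp 2 _ _).comp
    ((e.symm.continuous.comp continuous_fst).prodMk (e.symm.continuous.comp continuous_snd))
  have hdist : ∀ z w, dist z (mk w) =
      Real.sqrt ((w.1 - e z.fst) ^ 2 + (w.2 - e z.snd) ^ 2) := by
    intro z w
    have h : ∀ (x : EuclideanSpace ℝ (Fin 1)) (a : ℝ), dist x (e.symm a) ^ 2 = (a - e x) ^ 2 := by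
      intro x a
      rw [← e.dist_eq, e.apply_symm_apply, dist_comm, Real.dist_eq, sq_abs]
    rw [WithLp.prod_dist_eq_of_L2, ← h, ← h]
    rfl
  have hmkB : ∀ w : ℝ × ℝ, w.1 ∈ D₁ → w.2 ∈ D₂ → mk w ∈ euclideanProd C₁ C₂ :=
    fun w h h' => ⟨h, h'⟩
  -- A state is a point `(p, q)` and a sign `σ`. The next point lies to the right in the first
  -- coordinate and, after reflection by `σ`, to the left in the second. There it is a left end
  -- point, so the sign flips at each step.
  let S := {s : ℝ × ℝ × ℝ // s.2.2 * s.2.2 = 1 ∧ (∃ p', IsThickPiece D₁ τ₁ s.1 p') ∧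
    ∃ q', IsThickPiece {y | s.2.2 * y ∈ D₂} τ₂ q' (s.2.2 * s.2.1)}
  have hS : Nonempty S := ⟨⟨(a₁, b₂, 1), by norm_num, ⟨b₁, h₁⟩, a₂, by simpa using h₂⟩⟩
  have hmem : ∀ s : S, mk (s.1.1, s.1.2.1) ∈ euclideanProd C₁ C₂ := by
    rintro ⟨⟨p, q, σ⟩, hσ, ⟨p', hp⟩, q', hq⟩
    refine hmkB _ hp.left_mem ?_
    have h : σ * (σ * q) ∈ D₂ := hq.right_mem
    dsimp only at hσ
    rwa [← mul_assoc, hσ, one_mul] at h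
  refine interior_graphDistanceSet_nonempty (S := S)
    (fun s => 𝓝[euclideanProd C₁ C₂] (mk (s.1.1, s.1.2.1)))
    (fun s => mem_closure_iff_nhdsWithin_neBot.mp (subset_closure (hmem s)))
    (fun s => self_mem_nhdsWithin) ?_ hT
  rintro ⟨⟨x₁, x₂, σ⟩, hσ, ⟨p₀, hp₀⟩, q₀, hq₀⟩ δ hδ
  dsimp only at hσ hp₀ hq₀ ⊢
  have hEc : IsClosed {y | σ * y ∈ D₂} := hD₂c.preimage (continuous_const_mul σ)
  obtain ⟨p, p', q, hp, hq, hxp, hpδ, hqδ⟩ :=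
    exists_near_end_points hD₁c hEc hτ₁ hτ₂ hp₀ hq₀ (half_pos hδ)
  have hqx := hq.lt
  have hσsq : ∀ u v : ℝ, (σ * u - v) ^ 2 = (u - σ * v) ^ 2 := fun u v => by
    linear_combination (u ^ 2 - v ^ 2) * hσ
  set t₀ := Real.sqrt ((p - x₁) ^ 2 + (σ * x₂ - q) ^ 2) with ht₀
  have ht₀sq : t₀ ^ 2 = (p - x₁) ^ 2 + (σ * x₂ - q) ^ 2 := Real.sq_sqrt (by positivity)
  have ht₀pos : 0 < t₀ := Real.sqrt_pos.mpr (add_pos_of_pos_of_nonneg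
    (pow_pos (sub_pos.mpr hxp) 2) (sq_nonneg _))
  have ht₀δ : t₀ < δ := by
    refine lt_of_pow_lt_pow_left₀ 2 hδ.le ?_
    have h1 : (p - x₁) ^ 2 < (δ / 2) ^ 2 :=
      pow_lt_pow_left₀ (by linarith) (by linarith) two_ne_zero
    have h2 : (σ * x₂ - q) ^ 2 < (δ / 2) ^ 2 :=
      pow_lt_pow_left₀ (by linarith) (by linarith) two_ne_zero
    have h3 : 0 < δ ^ 2 := by positivity
    linarith
  refine ⟨⟨(p, σ * q, -σ), by simpa using hσ, ⟨p', hp⟩, -(σ * x₂), ?_⟩, t₀ / 2, half_pos ht₀pos, ?_⟩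
  · have h := hq.neg
    have h1 : -σ * (σ * q) = -q := by linear_combination (-q) * hσ
    simpa only [h1, Set.mem_ofPred_eq, neg_mul, mul_neg] using h
  intro A' hA'
  dsimp only at hA'
  obtain ⟨η, hη, hηA⟩ : ∃ η > 0, ∀ a ∈ D₁, ∀ b ∈ D₂, |a - p| < η → |b - σ * q| < η →
      mk (a, b) ∈ A' := by
    obtain ⟨U, hU, hUA⟩ := mem_nhdsWithin_iff_exists_mem_nhds_inter.mp hA'
    obtain ⟨η, hη, hball⟩ := Metric.mem_nhds_iff.mp (hmk.continuousAt.preimage_mem_nhds hU)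
    refine ⟨η, hη, fun a ha b hb hap hbq => hUA ⟨hball ?_, hmkB _ ha hb⟩⟩
    rw [Metric.mem_ball, Prod.dist_eq]
    exact max_lt hap hbq
  have hev := eventually_exists_sq_add_sq_eq hD₁c hEc hτ₁ hτ₂ hτ hp hq hxp hqx ht₀sq hη
  let φ : WithLp 2 (EuclideanSpace ℝ (Fin 1) × EuclideanSpace ℝ (Fin 1)) × ℝ → (ℝ × ℝ) × ℝ :=
    fun z => ((e z.1.fst, σ * e z.1.snd), z.2)
  have hφ : Continuous φ := by
    have h1 : Continuous fun z : WithLp 2 (EuclideanSpace ℝ (Fin 1) × EuclideanSpace ℝ (Fin 1)) =>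
        WithLp.ofLp z := WithLp.prod_continuous_ofLp 2 _ _
    have h2 := h1.comp (continuous_fst (Y := ℝ))
    exact ((e.continuous.comp (continuous_fst.comp h2)).prodMk
      (continuous_const.mul (e.continuous.comp (continuous_snd.comp h2)))).prodMk continuous_snd
  have hφ₀ : φ (mk (x₁, x₂), t₀) = ((x₁, σ * x₂), t₀) := by
    simp [φ, mk]
  have hev' := (hφ.tendsto (mk (x₁, x₂), t₀)).eventually (hφ₀.symm ▸ hev)
  rw [nhds_prod_eq] at hev'
  obtain ⟨A, hA, I, hI, hAI⟩ := mem_prod_iff.mp hev'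
  obtain ⟨κ, hκ, hκI⟩ := Metric.mem_nhds_iff.mp hI
  -- The lower bound `t₀ / 2` is fixed before `A'` is given; only `κ` depends on `A'`.
  refine ⟨A, mem_nhdsWithin_of_mem_nhds hA, max (t₀ - κ) (t₀ / 2), min (t₀ + κ) δ,
    le_max_right _ _, max_lt (lt_min (by linarith) (by linarith))
      (lt_min (by linarith) (by linarith)), min_le_right _ _, ?_⟩
  intro x hx t ht
  have ht₁ := (le_max_left _ _).trans_lt ht.1
  have ht₂ := (le_max_right _ _).trans_lt ht.1
  have ht₃ := ht.2.trans_le (min_le_left _ _)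
  have htI : t ∈ I := hκI (by
    rw [Metric.mem_ball, Real.dist_eq, abs_lt]
    exact ⟨by linarith, by linarith⟩)
  obtain ⟨a, ha, b, hb, hap, hbq, hab⟩ := hAI (Set.mk_mem_prod hx htI)
  have hσabs : |σ| = 1 := by
    have h : |σ| * |σ| = 1 := by rw [abs_mul_abs_self, hσ]
    exact (mul_self_eq_one_iff.mp h).resolve_right (by linarith [abs_nonneg σ])
  refine ⟨mk (a, σ * b), hηA a ha _ hb hap ?_, ?_⟩
  · rw [← mul_sub, abs_mul, hσabs, one_mul]
    exact hbq
  · have hab' : (a - e x.fst) ^ 2 + (b - σ * e x.snd) ^ 2 = t ^ 2 := hab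
    rw [hdist, hσsq, hab', Real.sqrt_sq (by linarith)]

/-- A product in `ℝ≥0∞` is bounded by any bound for the products of strictly smaller factors;
infinite thickness is thus replaced by a finite constant. -/
theorem ENNReal.exists_real_lt_of_one_lt_mul {x y : ℝ≥0∞} (h : 1 < x * y) :
    ∃ a b : ℝ, 0 < a ∧ 0 < b ∧ ENNReal.ofReal a < x ∧ ENNReal.ofReal b < y ∧ 1 < a * b := by
  by_contra! hcon
  refine absurd h (not_lt.mpr (ENNReal.mul_le_of_forall_lt fun a ha b hb => ?_))
  lift a to NNReal using ha.ne_top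
  lift b to NNReal using hb.ne_top
  rcases eq_or_ne a 0 with rfl | ha0
  · simp
  rcases eq_or_ne b 0 with rfl | hb0
  · simp
  have := hcon a b (by positivity) (by positivity) (by simpa using ha) (by simpa using hb)
  exact_mod_cast this

theorem mainTheorem4 {d : ℕ} (hd : 1 ≤ d) (C₁ C₂ : Set (EuclideanSpace ℝ (Fin d)))
    (hC₁ : IsCompact C₁) (hC₂ : IsCompact C₂) (hτ : 1 < thickness C₁ * thickness C₂)
    {V : Type*} [Finite V] (T : SimpleGraph V) (hT : T.IsTree) :
    (interior (graphDistanceSet T (euclideanProd C₁ C₂))).Nonempty := by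
  rcases hd.eq_or_lt with rfl | hd'
  · obtain ⟨τ₁, τ₂, hτ₁, hτ₂, h₁, h₂, h⟩ := ENNReal.exists_real_lt_of_one_lt_mul hτ
    let e := (OrthonormalBasis.singleton (Fin 1) ℝ).repr.symm.toIsometryEquiv
    obtain ⟨_, _, hp₁⟩ := exists_isThickPiece e hC₁ hτ₁ h₁
    obtain ⟨_, _, hp₂⟩ := exists_isThickPiece e hC₂ hτ₂ h₂
    exact interior_graphDistanceSet_euclideanProd_nonempty_of_isThickPiece e hC₁.isClosed
      hC₂.isClosed hτ₁ hτ₂ h hp₁ hp₂ hT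
  · refine interior_graphDistanceSet_euclideanProd_nonempty_of_two_le hd' C₁ C₂ hC₁.isClosed
      ?_ ?_ hT
    · intro h
      simp [h] at hτ
    · intro h
      simp [h] at hτ
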